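/- \textbf{Theorem (Recurrence Formula).} Let $F=\mathbb Q(t)$, let $p_k=\sum_i x_i^k$ be the power sums in infinitely many variables, and put $p_\mu=\prod_i p_{\mu_i}$, $z_\mu=\prod_{i\ge1}i^{m_i(\mu)}m_i(\mu)!$ and $z_\mu(t)=z_\mu/\prod_i(1-t^{\mu_i})$ for a partition $\mu$, where $m_i(\mu)$ is the multiplicity of $i$ in $\mu$. Let $q_n=\sum_{\rho\vdash n}z_\rho(t)^{-1}p_\rho$ for $n\ge 0$, and $q_n=0$ for $n<0$. For a partition $\lambda=(\lambda_1\ge\dots\ge\lambda_l>0)$ let $$Q_\lambda(t)=\prod_{1\le i<j\le l}\frac{1-R_{ij}}{1-tR_{ij}}\,q_{\lambda_1}\cdots q_{\lambda_l},\qquad P_\lambda(t)=b_\lambda(t)^{-1}Q_\lambda(t),\qquad b_\lambda(t)=\prod_{i\ge1}\prod_{j=1}^{m_i(\lambda)}(1-t^j),$$ be the Hall--Littlewood functions, where the raising operator $R_{ij}$ adds $1$ to the $i$-th index and subtracts $1$ from the $j$-th index (the product is expanded in powers of the $R_{ij}$). Every $p_\mu$ is in a unique way a finite $F$-linear combination of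 the $P_\lambda(t)$, over partitions $\lambda$ of all sizes; let $X^\lambda_\mu(t)\in F$ be the coefficient of $P_\lambda(t)$ in it. For $\mu\vdash n$ only the $\lambda\vdash n$ occur, so that $p_\mu=\sum_{\lambda\vdash n}X^\lambda_\mu(t)P_\lambda(t)$. For all $n\ge0$ and all partitions $\lambda,\mu\vdash n$, $$X^\lambda_\mu(t)=\sum_{\substack{\tau\lhd\mu\\ |\tau|\le n-\lambda_1}}\ \sum_{\rho\vdash|\lambda^{[1]}|-|\tau|}\frac{(-1)^{l(\rho)}}{z_\rho(t)}X^{\lambda^{[1]}}_{\tau\cup\rho}(t)=\sum_{i=0}^{n-\lambda_1}\ \sum_{\substack{\tau\lhd\mu\\ \tau\vdash i}}\ \sum_{\rho\vdash n-\lambda_1-i}\frac{(-1)^{l(\rho)}}{z_\rho(t)}X^{\lambda^{[1]}}_{\tau\cup\rho}(t).$$ Here $\lambda^{[1]}=(\lambda_2,\lambda_3,\dots)\vdash n-\lambda_1$ (for $\lambda=\emptyset$: $\lambda_1=0$ and $\lambda^{[1]}=\emptyset$), $l(\rho)$ is the number of parts of $\rho$, $\tau\cup\rho$ is the partition whose parts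 are those of $\tau$ and of $\rho$ together, and $\tau\lhd\mu$ runs over the $2^{l(\mu)}$ subpartitions $(\mu_{i_1},\dots,\mu_{i_s})$, $1\le i_1<\dots<i_s\le l(\mu)$, counted with multiplicity, one for each choice of positions. Thus Green polynomials are reduced to Green polynomials with one fewer row. -/

import Mathlib

open scoped BigOperators

noncomputable section

namespace Green

/-- The field `F = ℚ(t)` of rational functions in `t`. -/
abbrev F : Type := RatFunc ℚ

/-- The indeterminate `t`. -/
def t : F := RatFunc.X

/-- Formal power series over `F` in the variables `x_0, x_1, x_2, …`; the symmetric functions over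
`F` are elements of this ring. -/
abbrev Series : Type := MvPowerSeries ℕ F

/-- The power sum `p_k = ∑ i, x_i ^ k` (for `k ≥ 1`): the coefficient of a monomial is `1` if the
monomial is `x_i ^ k` for some `i`, and `0` otherwise. -/
def powerSum (k : ℕ) : Series :=
  open Classical in fun d => if ∃ i : ℕ, d = Finsupp.single i k then 1 else 0

/-- `p_μ`, the product of the `p_{μ_i}` over the parts of `μ`. -/
def powerSumPart {n : ℕ} (mu : n.Partition) : Series := (mu.parts.map powerSum).prod

/-- `z_μ = ∏_{i ≥ 1} i ^ {m_i(μ)} m_i(μ)!`. -/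
def zNum {n : ℕ} (mu : n.Partition) : ℕ :=
  ∏ i ∈ mu.parts.toFinset, i ^ mu.parts.count i * (mu.parts.count i).factorial

/-- `z_μ(t) = z_μ / ∏_i (1 - t ^ {μ_i})`. -/
def z {n : ℕ} (mu : n.Partition) : F :=
  (zNum mu : F) / (mu.parts.map fun i => 1 - t ^ i).prod

/-- The Hall–Littlewood function of one row, `q_n = ∑_{ρ ⊢ n} z_ρ(t)⁻¹ p_ρ`. -/
def qNat (n : ℕ) : Series := ∑ rho : n.Partition, (z rho)⁻¹ • powerSumPart rho

/-- `q_a` for an integer index `a`, with `q_a = 0` for `a < 0`. -/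
def q (a : ℤ) : Series := if 0 ≤ a then qNat a.toNat else 0

/-- The coefficient of `R ^ k` in `(1 - R) / (1 - t R) = 1 + ∑_{k ≥ 1} (t ^ k - t ^ (k - 1)) R ^ k`. -/
def raisingCoeff (k : ℕ) : F := if k = 0 then 1 else t ^ k - t ^ (k - 1)

/-- The pairs `i < j` of positions in a sequence of length `l`. -/
abbrev Pairs (l : ℕ) : Type := {p : Fin l × Fin l // p.1 < p.2}

/-- The index `(∏_{i < j} R_{ij} ^ {K_{ij}}) α`, where the raising operator `R_{ij}` adds `1` to the
`i`-th entry and subtracts `1` from the `j`-th entry. -/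
def raise {l : ℕ} (K : Pairs l → ℕ) (alpha : Fin l → ℤ) : Fin l → ℤ :=
  alpha + ∑ p : Pairs l, (K p : ℤ) • (Pi.single p.1.1 1 - Pi.single p.1.2 1)

/-- `∏_{i < j} (1 - R_{ij}) / (1 - t R_{ij}) q_{α_1} ⋯ q_{α_l}`. The operators are expanded in powers
of the `R_{ij}` and act on the index; only finitely many of the resulting terms are nonzero. -/
def raisingSum {l : ℕ} (alpha : Fin l → ℤ) : Series :=
  ∑ᶠ K : Pairs l → ℕ, (∏ p : Pairs l, raisingCoeff (K p)) • ∏ i : Fin l, q (raise K alpha i)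

/-- The parts of a partition as a weakly decreasing list. -/
def rows {n : ℕ} (lam : n.Partition) : List ℕ := lam.parts.sort (· ≥ ·)

/-- The Hall–Littlewood function `Q_λ(t)`. -/
def hallLittlewoodQ {n : ℕ} (lam : n.Partition) : Series :=
  raisingSum fun i : Fin (rows lam).length => ((rows lam).get i : ℤ)

/-- `b_λ(t) = ∏_{i ≥ 1} ∏_{j = 1}^{m_i(λ)} (1 - t ^ j)`. -/
def b {n : ℕ} (lam : n.Partition) : F :=
  ∏ i ∈ lam.parts.toFinset, ∏ j ∈ Finset.Icc 1 (lam.parts.count i), (1 - t ^ j)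

/-- The Hall–Littlewood function `P_λ(t) = b_λ(t)⁻¹ Q_λ(t)`, for partitions `λ` of all sizes. -/
def hallLittlewoodP (lam : Σ n : ℕ, n.Partition) : Series := (b lam.2)⁻¹ • hallLittlewoodQ lam.2

/-- `c` is a family of coefficients of `p_μ` with respect to the functions `P_λ`:
`p_μ = ∑_λ c_λ P_λ(t)`. -/
def IsExpansion {n : ℕ} (mu : n.Partition) (c : (Σ m : ℕ, m.Partition) →₀ F) : Prop :=
  powerSumPart mu = Finsupp.linearCombination F hallLittlewoodP c

/-- The Green polynomial `X^λ_μ(t)`: the coefficient of `P_λ(t)` in `p_μ`. -/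
def greenX {m n : ℕ} (lam : m.Partition) (mu : n.Partition) : F :=
  Classical.epsilon (IsExpansion mu) ⟨m, lam⟩

/-- The largest part `λ_1` (`0` for the empty partition). -/
def firstPart {n : ℕ} (lam : n.Partition) : ℕ := lam.parts.sup

/-- The largest part of a nonempty multiset of natural numbers belongs to it. -/
theorem sup_mem {s : Multiset ℕ} (hs : s ≠ 0) : s.sup ∈ s := by
  induction s using Multiset.induction with
  | empty => exact absurd rfl hs
  | cons a s ih =>
    rw [Multiset.sup_cons]
    by_cases h : s = 0
    · subst h; simp
    · rcases le_total a s.sup with h' | h'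
      · rw [sup_eq_right.2 h']; exact Multiset.mem_cons_of_mem (ih h)
      · rw [sup_eq_left.2 h']; exact Multiset.mem_cons_self a s

/-- `λ^{[1]} = (λ_2, λ_3, …)`, a partition of `n - λ_1`. -/
def removeFirst {n : ℕ} (lam : n.Partition) : (n - firstPart lam).Partition where
  parts := lam.parts.erase (firstPart lam)
  parts_pos h := lam.parts_pos (Multiset.mem_of_mem_erase h)
  parts_sum := by
    by_cases h : lam.parts = 0
    · have hn : n = 0 := by rw [← lam.parts_sum, h, Multiset.sum_zero]
      simp [h, hn]
    · have h1 := Multiset.sum_erase (sup_mem h)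
      rw [lam.parts_sum] at h1
      simp only [firstPart]
      omega

/-- The subpartitions `(μ_{i_1}, …, μ_{i_s})`, `1 ≤ i_1 < ⋯ < i_s ≤ l(μ)`, of `μ`. They are listed
with multiplicity, one for each of the `2 ^ l(μ)` choices of positions. -/
def subpartitions {n : ℕ} (mu : n.Partition) : Multiset (Multiset ℕ) := mu.parts.powerset

end Green

end

open scoped BigOperators

noncomputable section

namespace Green

/-! Work in `Lam = F[p_1, p_2, …]` with the inner product `pairing`, for which the `p_μ` are
orthogonal with norms `z_μ(t)`. Let `H_ε(w) = exp(ε ∑ (1 - t^k) p_k w^k / k)`, with coefficients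
`hRow ε n`; thus `hRow 1 n` is `q_n`, and `H_{-1}` is the inverse of `H_1`. The adjoint of
multiplication by `hRow ε n` is the coefficient of `z^n` in the substitution `p_k ↦ p_k + ε z^k`
(`pairing_hRow_mul`). Combining multiplications with substitutions gives the vertex operators
`vertexOp ε m`; the adjoint of `vertexOp ε m` is `vertexOp (-ε) (-m)` (`pairing_vertexOp`).

The operator `creation m` puts a row `m` in front. On products of the `q_a` it acts as the factors
`(1 - R_{1j}) / (1 - t R_{1j})` do (`raisingLam_cons`), so `Q_λ` is obtained by applying creation
operators to `1`. The commutation rule `annihilation_creation` then makes the `Q_λ` orthogonal with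
norms `b_λ(t)` (`pairing_rowQ`). Hence `P_λ` is dual to `Q_λ`, and `X^λ_μ` is the inner product of
`p_μ` with `Q_λ` (`greenX_eq_pairing`).

The recurrence is now one use of adjointness: write `Q_λ` as `creation λ_1` applied to `Q` of
`λ^{[1]}` and move the operator onto `p_μ`. The substitution `p_k ↦ p_k + z^k` expands `p_μ` over
its subpartitions `τ`, and each term is multiplied by a coefficient of `H_{-1}`, that is, by a sum
of `(-1)^{l(ρ)} z_ρ(t)⁻¹ p_ρ` (`annihilation_pwMul`, `hRow_eq_sum`).

To return to power series in the `x_i`, `coeff_toSeries` identifies the coefficient of a monomial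
with the inner product against a product of `q_n`. As these products span `Lam`, the realization is
injective. -/

/-! ### Complete functions and Newton's identity -/

/-- The number `z_s` attached to a multiset `s` of parts. -/
def zMul (s : Multiset ℕ) : ℕ :=
  ∏ i ∈ s.toFinset, i ^ s.count i * (s.count i).factorial

theorem zMul_cons (k : ℕ) (s : Multiset ℕ) :
    zMul (k ::ₘ s) = k * (s.count k + 1) * zMul s := by
  have h1 : zMul (k ::ₘ s) = ∏ i ∈ insert k s.toFinset,
      i ^ (k ::ₘ s).count i * ((k ::ₘ s).count i).factorial := by
    rw [zMul, Multiset.toFinset_cons]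
  have h2 : zMul s = ∏ i ∈ insert k s.toFinset, i ^ s.count i * (s.count i).factorial := by
    rw [zMul]
    refine Finset.prod_subset (Finset.subset_insert _ _) fun i _ hi => ?_
    rw [Multiset.mem_toFinset] at hi
    simp [Multiset.count_eq_zero_of_notMem hi]
  rw [h1, h2, ← Finset.mul_prod_erase _ _ (Finset.mem_insert_self k s.toFinset),
    ← Finset.mul_prod_erase _ (fun i => i ^ s.count i * (s.count i).factorial)
      (Finset.mem_insert_self k s.toFinset)]
  rw [Finset.prod_congr rfl (g := fun i => i ^ s.count i * (s.count i).factorial)]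
  · rw [Multiset.count_cons_self, pow_succ, Nat.factorial_succ]; ring
  · intro i hi
    rw [Multiset.count_cons_of_ne (Finset.ne_of_mem_erase hi)]

theorem zMul_pos {s : Multiset ℕ} (hs : ∀ i ∈ s, 0 < i) : 0 < zMul s :=
  Finset.prod_pos fun i hi => Nat.mul_pos (pow_pos (hs i (Multiset.mem_toFinset.1 hi)) _)
    (Nat.factorial_pos _)

/-- The partitions of `n` as multisets. -/
def partitionFinset (n : ℕ) : Finset (Multiset ℕ) :=
  (Finset.univ : Finset n.Partition).image Nat.Partition.parts

theorem mem_partitionFinset {n : ℕ} {s : Multiset ℕ} :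
    s ∈ partitionFinset n ↔ (∀ i ∈ s, 0 < i) ∧ s.sum = n := by
  simp only [partitionFinset, Finset.mem_image, Finset.mem_univ, true_and]
  constructor
  · rintro ⟨r, rfl⟩
    exact ⟨fun i hi => r.parts_pos hi, r.parts_sum⟩
  · rintro ⟨h1, h2⟩
    exact ⟨⟨s, fun {i} hi => h1 i hi, h2⟩, rfl⟩

theorem sum_partitionFinset {M : Type*} [AddCommMonoid M] (n : ℕ) (f : Multiset ℕ → M) :
    ∑ s ∈ partitionFinset n, f s = ∑ r : n.Partition, f r.parts := by
  rw [partitionFinset, Finset.sum_image]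
  intro a _ b _ h
  exact Nat.Partition.ext h

/-- The complete function of a sequence `c` of power sums. -/
def completeSum {R : Type*} [CommRing R] [Algebra F R] (c : ℕ → R) (n : ℕ) : R :=
  ∑ s ∈ partitionFinset n, (zMul s : F)⁻¹ • (s.map c).prod

theorem completeSum_zero {R : Type*} [CommRing R] [Algebra F R] (c : ℕ → R) :
    completeSum c 0 = 1 := by
  have : partitionFinset 0 = {0} := by
    ext s
    rw [mem_partitionFinset, Finset.mem_singleton]
    constructor
    · rintro ⟨h1, h2⟩
      refine Multiset.eq_zero_of_forall_notMem fun i hi => ?_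
      have := h1 i hi
      have := Multiset.le_sum_of_mem hi
      omega
    · rintro rfl; simp
  simp [completeSum, this, zMul]

/-- Newton's identity, by marking: the numbers `k * count k` over the distinct parts `k` of a
partition of `n` add up to `n`. Deleting one copy of the marked part leaves a partition of `n - k`,
and by `zMul_cons` the weight turns the old `z` into the new one. -/
theorem nsmul_completeSum {R : Type*} [CommRing R] [Algebra F R] (c : ℕ → R) (n : ℕ) :
    n • completeSum c n =
      ∑ p ∈ Finset.HasAntidiagonal.antidiagonal n, (if p.1 = 0 then 0 else c p.1) * completeSum c p.2 := by
  have hL : n • completeSum c n = ∑ x ∈ (partitionFinset n).sigma fun s => s.toFinset,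
      ((x.1.count x.2 * x.2 : ℕ) : F) • (zMul x.1 : F)⁻¹ • (x.1.map c).prod := by
    rw [Finset.sum_sigma, completeSum, Finset.smul_sum]
    refine Finset.sum_congr rfl fun s hs => ?_
    simp only
    rw [← Finset.sum_smul, ← Nat.cast_sum]
    have : s.sum = n := (mem_partitionFinset.1 hs).2
    rw [Finset.sum_multiset_count] at this
    simp only [smul_eq_mul] at this
    rw [this, Nat.cast_smul_eq_nsmul]
  have hR : ∑ p ∈ Finset.HasAntidiagonal.antidiagonal n, (if p.1 = 0 then 0 else c p.1) * completeSum c p.2 =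
      ∑ x ∈ ((Finset.HasAntidiagonal.antidiagonal n).filter fun p => p.1 ≠ 0).sigma
        fun p => partitionFinset p.2, c x.1.1 * ((zMul x.2 : F)⁻¹ • (x.2.map c).prod) := by
    rw [Finset.sum_sigma, Finset.sum_filter]
    refine Finset.sum_congr rfl fun p _ => ?_
    by_cases h : p.1 = 0
    · simp [h]
    · simp [h, completeSum, Finset.mul_sum]
  rw [hL, hR]
  refine Finset.sum_bij' (fun x _ => ⟨(x.2, n - x.2), x.1.erase x.2⟩)
    (fun x _ => ⟨x.1.1 ::ₘ x.2, x.1.1⟩) ?_ ?_ ?_ ?_ ?_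
  · rintro ⟨s, k⟩ hx
    simp only [Finset.mem_sigma, mem_partitionFinset, Multiset.mem_toFinset, Finset.mem_filter,
      Finset.HasAntidiagonal.mem_antidiagonal] at hx ⊢
    obtain ⟨⟨h1, h2⟩, hk⟩ := hx
    have h3 := Multiset.sum_erase hk
    have := h1 k hk
    refine ⟨⟨by omega, by omega⟩, fun i hi => h1 i (Multiset.mem_of_mem_erase hi), by omega⟩
  · rintro ⟨⟨k, j⟩, s⟩ hx
    simp only [Finset.mem_sigma, mem_partitionFinset, Multiset.mem_toFinset, Finset.mem_filter,
      Finset.HasAntidiagonal.mem_antidiagonal] at hx ⊢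
    obtain ⟨⟨h1, h2⟩, h3, h4⟩ := hx
    refine ⟨⟨fun i hi => ?_, by rw [Multiset.sum_cons]; omega⟩, Multiset.mem_cons_self _ _⟩
    rcases Multiset.mem_cons.1 hi with rfl | h
    · omega
    · exact h3 i h
  · rintro ⟨s, k⟩ hx
    simp only [Finset.mem_sigma, Multiset.mem_toFinset] at hx
    simp [Multiset.cons_erase hx.2]
  · rintro ⟨⟨k, j⟩, s⟩ hx
    simp only [Finset.mem_sigma, Finset.mem_filter, Finset.HasAntidiagonal.mem_antidiagonal] at hx
    have : n - k = j := by omega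
    simp [this]
  · rintro ⟨s, k⟩ hx
    simp only [Finset.mem_sigma, mem_partitionFinset, Multiset.mem_toFinset] at hx
    obtain ⟨⟨h1, -⟩, hk⟩ := hx
    obtain ⟨s', rfl⟩ := Multiset.exists_cons_of_mem hk
    have hk0 : 0 < k := h1 k hk
    have hz : 0 < zMul s' := zMul_pos fun i hi => h1 i (Multiset.mem_cons_of_mem hi)
    simp only [Multiset.erase_cons_head, Multiset.map_cons, Multiset.prod_cons,
      Multiset.count_cons_self, zMul_cons, mul_smul_comm, smul_smul]
    congr 1
    have h1 : (k : F) ≠ 0 := by exact_mod_cast hk0.ne'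
    have h2 : ((Multiset.count k s' : F) + 1) ≠ 0 :=
      Nat.cast_add_one_ne_zero _
    have h3 : (zMul s' : F) ≠ 0 := by exact_mod_cast hz.ne'
    push_cast
    field_simp

/-- Solutions of `X y' = C y` are determined by their constant coefficient. -/
theorem eq_of_logDerivative {R : Type*} [CommRing R] [Algebra F R]
    {C y y' : PowerSeries R} (hC : PowerSeries.constantCoeff C = 0)
    (hy : PowerSeries.X * PowerSeries.derivative R y = C * y)
    (hy' : PowerSeries.X * PowerSeries.derivative R y' = C * y')
    (h0 : PowerSeries.constantCoeff y = PowerSeries.constantCoeff y') : y = y' := by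
  rw [← sub_eq_zero]
  set u := y - y' with hu
  have hu0 : PowerSeries.coeff 0 u = 0 := by simp [hu, h0]
  have hode : PowerSeries.X * PowerSeries.derivative R u = C * u := by
    rw [hu, map_sub, mul_sub, mul_sub, hy, hy']
  ext n
  induction n using Nat.strong_induction_on with
  | _ n ih =>
    rcases n with _ | n
    · simpa using hu0
    · have h1 := congrArg (PowerSeries.coeff (n + 1)) hode
      rw [PowerSeries.coeff_succ_X_mul, PowerSeries.coeff_derivative, PowerSeries.coeff_mul,
        Finset.sum_eq_zero] at h1
      · have h2 : ((n + 1 : ℕ) : F) • PowerSeries.coeff (n + 1) u = 0 := by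
          rw [Nat.cast_smul_eq_nsmul, nsmul_eq_mul, mul_comm]; push_cast; exact h1
        have h3 : ((n + 1 : ℕ) : F) ≠ 0 := by exact_mod_cast Nat.succ_ne_zero n
        simpa using (smul_eq_zero_iff_right h3).1 h2
      · rintro ⟨i, j⟩ hij
        rw [Finset.HasAntidiagonal.mem_antidiagonal] at hij
        simp only at hij ⊢
        rcases Nat.eq_zero_or_pos i with rfl | hi
        · rw [PowerSeries.coeff_zero_eq_constantCoeff_apply, hC, zero_mul]
        · rw [ih j (by omega)]; simp

/-! ### One-row generating series -/

/-- The ring of symmetric functions: polynomials in the power sums, where the variable `X k`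
stands for `p_{k+1}`. -/
abbrev Lam : Type := MvPolynomial ℕ F

/-- The power sum `p_k`, `k ≥ 1`. -/
def pw (k : ℕ) : Lam := MvPolynomial.X (k - 1)

/-- `ε (1 - t ^ k) p_k`. -/
def scaledPw (ε : F) (k : ℕ) : Lam := (ε * (1 - t ^ k)) • pw k

/-- The coefficient of `w ^ n` in `exp (∑ k, ε (1 - t ^ k) p_k w ^ k / k)`. -/
def hRow (ε : F) (n : ℕ) : Lam := completeSum (scaledPw ε) n

/-- The generating function of `hRow ε`. -/
def hSeries (ε : F) : PowerSeries Lam := PowerSeries.mk (hRow ε)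

/-- `∑ k ≥ 1, ε (1 - t ^ k) p_k w ^ k`. -/
def pwSeries (ε : F) : PowerSeries Lam :=
  PowerSeries.mk fun k => if k = 0 then 0 else scaledPw ε k

theorem hRow_zero (ε : F) : hRow ε 0 = 1 := completeSum_zero _

theorem nsmul_hRow (ε : F) (n : ℕ) :
    n • hRow ε n = ∑ p ∈ Finset.HasAntidiagonal.antidiagonal n,
      (if p.1 = 0 then 0 else scaledPw ε p.1) * hRow ε p.2 := nsmul_completeSum _ n

theorem constantCoeff_hSeries (ε : F) : PowerSeries.constantCoeff (hSeries ε) = 1 := by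
  rw [← PowerSeries.coeff_zero_eq_constantCoeff_apply, hSeries, PowerSeries.coeff_mk, hRow_zero]

theorem coeff_X_mul_derivative {R : Type*} [CommRing R] (y : PowerSeries R) (n : ℕ) :
    PowerSeries.coeff n (PowerSeries.X * PowerSeries.derivative R y) =
      n • PowerSeries.coeff n y := by
  rcases n with _ | n
  · simp
  · rw [PowerSeries.coeff_succ_X_mul, PowerSeries.coeff_derivative, nsmul_eq_mul, mul_comm]
    push_cast
    rfl

theorem derivative_mul_eq {R : Type*} [CommRing R] (y y' : PowerSeries R) :
    PowerSeries.derivative R (y * y') =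
      y * PowerSeries.derivative R y' + y' * PowerSeries.derivative R y := by
  rw [Derivation.leibniz, smul_eq_mul, smul_eq_mul]

theorem hSeries_logDerivative (ε : F) :
    PowerSeries.X * PowerSeries.derivative Lam (hSeries ε) = pwSeries ε * hSeries ε := by
  ext1 n
  rw [coeff_X_mul_derivative, PowerSeries.coeff_mul, hSeries, PowerSeries.coeff_mk, nsmul_hRow]
  simp only [pwSeries, PowerSeries.coeff_mk]

theorem constantCoeff_pwSeries (ε : F) : PowerSeries.constantCoeff (pwSeries ε) = 0 := by
  rw [← PowerSeries.coeff_zero_eq_constantCoeff_apply, pwSeries, PowerSeries.coeff_mk, if_pos rfl]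

/-- The logarithmic derivatives of the two factors cancel, so the product has derivative zero and
constant term one. -/
theorem hSeries_mul_hSeries_neg (ε : F) : hSeries ε * hSeries (-ε) = 1 := by
  refine eq_of_logDerivative (C := 0) (map_zero _) ?_ ?_ ?_
  · have hneg : pwSeries (-ε) = -pwSeries ε := by
      ext1 n
      rw [map_neg, pwSeries, pwSeries, PowerSeries.coeff_mk, PowerSeries.coeff_mk]
      split_ifs
      · simp
      · simp [scaledPw]
    have h1 := hSeries_logDerivative ε
    have h2 := hSeries_logDerivative (-ε)
    rw [hneg] at h2
    rw [derivative_mul_eq]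
    linear_combination hSeries ε * h2 + hSeries (-ε) * h1
  · rw [PowerSeries.derivative_one]; simp
  · rw [map_mul, constantCoeff_hSeries, constantCoeff_hSeries]; simp

theorem sum_hRow_mul_hRow_neg (ε : F) (n : ℕ) :
    ∑ p ∈ Finset.HasAntidiagonal.antidiagonal n, hRow ε p.1 * hRow (-ε) p.2 =
      if n = 0 then 1 else 0 := by
  have h := congrArg (PowerSeries.coeff n) (hSeries_mul_hSeries_neg ε)
  rw [PowerSeries.coeff_mul, PowerSeries.coeff_one] at h
  simpa only [hSeries, PowerSeries.coeff_mk] using h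

/-! ### Derivations adjoint to the power sums -/

/-- The scalar `k / (1 - t ^ k)` with `k` replaced by `k + 1`. -/
def kap (k : ℕ) : F := ((k + 1 : ℕ) : F) / (1 - t ^ (k + 1))

theorem one_sub_t_pow_ne_zero {k : ℕ} (hk : k ≠ 0) : (1 : F) - t ^ k ≠ 0 := by
  rw [sub_ne_zero, t, ← RatFunc.algebraMap_X, ← map_pow, ← map_one (algebraMap (Polynomial ℚ) _)]
  intro h
  have h1 := RatFunc.algebraMap_injective ℚ h
  have h2 := congrArg Polynomial.natDegree h1
  rw [Polynomial.natDegree_one, Polynomial.natDegree_X_pow] at h2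
  exact hk h2.symm

theorem kap_ne_zero (k : ℕ) : kap k ≠ 0 :=
  div_ne_zero (by exact_mod_cast Nat.succ_ne_zero k) (one_sub_t_pow_ne_zero (Nat.succ_ne_zero k))

/-- The derivation `k / (1 - t ^ k) ∂ / ∂ p_k`, with `k` replaced by `k + 1`. -/
def adj (k : ℕ) : Derivation F Lam Lam := kap k • MvPolynomial.pderiv k

theorem adj_X (k j : ℕ) : adj k (MvPolynomial.X j) = if j = k then algebraMap F Lam (kap k) else 0 := by
  rw [adj, Derivation.smul_apply, MvPolynomial.pderiv_X, Pi.single_apply]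
  split_ifs with h
  · rw [Algebra.algebraMap_eq_smul_one]
  · simp

/-- `adj` applied to the coefficients of a power series. -/
def adjSeries (k : ℕ) (y : PowerSeries Lam) : PowerSeries Lam :=
  PowerSeries.mk fun n => adj k (PowerSeries.coeff n y)

theorem adjSeries_mul (k : ℕ) (y y' : PowerSeries Lam) :
    adjSeries k (y * y') = y * adjSeries k y' + adjSeries k y * y' := by
  ext1 n
  simp only [adjSeries, map_add, PowerSeries.coeff_mk, PowerSeries.coeff_mul, map_sum,
    Derivation.leibniz, smul_eq_mul, Finset.sum_add_distrib]
  congr 1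
  exact Finset.sum_congr rfl fun p _ => mul_comm _ _

theorem coeff_smul_scalar (c : F) (y : PowerSeries Lam) (n : ℕ) :
    PowerSeries.coeff n (c • y) = c • PowerSeries.coeff n y := rfl

/-- The normalization of `adj` sends the exponent `∑ ε (1 - t^j) p_j w^j / j` to `ε w^(k+1)`, and a
derivation multiplies an exponential by the derivative of its exponent. -/
theorem adjSeries_hSeries (ε : F) (k : ℕ) :
    adjSeries k (hSeries ε) = ε • (PowerSeries.X ^ (k + 1) * hSeries ε) := by
  have h1 : adjSeries k (PowerSeries.X * PowerSeries.derivative Lam (hSeries ε)) =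
      PowerSeries.X * PowerSeries.derivative Lam (adjSeries k (hSeries ε)) := by
    ext1 n
    rw [adjSeries, PowerSeries.coeff_mk, coeff_X_mul_derivative, coeff_X_mul_derivative, adjSeries,
      PowerSeries.coeff_mk, map_nsmul]
  have h2 : adjSeries k (pwSeries ε) = (ε * (k + 1)) • PowerSeries.X ^ (k + 1) := by
    ext1 n
    rw [adjSeries, PowerSeries.coeff_mk, pwSeries, PowerSeries.coeff_mk]
    simp only [coeff_smul_scalar, PowerSeries.coeff_X_pow]
    rcases n with _ | n
    · simp
    · simp only [Nat.succ_ne_zero, if_false, scaledPw, pw, Nat.add_sub_cancel, Derivation.map_smul,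
        adj_X, Nat.succ_inj]
      split_ifs with h
      · subst h
        rw [Algebra.algebraMap_eq_smul_one, smul_smul, kap]
        congr 1
        have := one_sub_t_pow_ne_zero (Nat.succ_ne_zero n)
        rw [Nat.succ_eq_add_one] at this
        push_cast
        field_simp
      · simp
  -- Both sides solve the same inhomogeneous equation, so their difference solves the homogeneous
  -- one with zero constant term.
  rw [← sub_eq_zero]
  refine eq_of_logDerivative (C := pwSeries ε) (constantCoeff_pwSeries ε) ?_ (by simp) ?_
  · rw [map_sub, mul_sub, ← h1, hSeries_logDerivative, adjSeries_mul, h2]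
    have h3 := hSeries_logDerivative ε
    have h4 : PowerSeries.derivative Lam (ε • (PowerSeries.X ^ (k + 1) * hSeries ε)) =
        ε • PowerSeries.derivative Lam (PowerSeries.X ^ (k + 1) * hSeries ε) := by
      ext1 n
      simp
    rw [h4, Derivation.leibniz, Derivation.leibniz_pow, PowerSeries.derivative_X]
    simp only [smul_eq_mul, Algebra.smul_def, nsmul_eq_mul, Nat.add_sub_cancel, map_mul, map_add,
      map_natCast, map_one]
    push_cast
    linear_combination -(algebraMap F (PowerSeries Lam) ε) * PowerSeries.X ^ (k + 1) * h3
  · rw [← PowerSeries.coeff_zero_eq_constantCoeff_apply,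
      ← PowerSeries.coeff_zero_eq_constantCoeff_apply, map_sub, adjSeries, PowerSeries.coeff_mk,
      hSeries, PowerSeries.coeff_mk, hRow_zero]
    simp

theorem adj_hRow (ε : F) (k n : ℕ) :
    adj k (hRow ε n) = if k + 1 ≤ n then ε • hRow ε (n - (k + 1)) else 0 := by
  have h := congrArg (PowerSeries.coeff n) (adjSeries_hSeries ε k)
  rw [adjSeries, PowerSeries.coeff_mk, hSeries, PowerSeries.coeff_mk] at h
  rw [h, coeff_smul_scalar, PowerSeries.coeff_X_pow_mul']
  split_ifs
  · rw [PowerSeries.coeff_mk]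
  · simp

/-! ### The substitution `p_k ↦ p_k + ε z ^ k` -/

/-- The homomorphism `p_k ↦ p_k + ε z ^ k`. -/
def shift (ε : F) : Lam →ₐ[F] Polynomial Lam :=
  MvPolynomial.aeval fun k =>
    Polynomial.C (MvPolynomial.X k) + Polynomial.monomial (k + 1) (algebraMap F Lam ε)

theorem shift_X (ε : F) (k : ℕ) : shift ε (MvPolynomial.X k) =
    Polynomial.C (MvPolynomial.X k) + Polynomial.monomial (k + 1) (algebraMap F Lam ε) :=
  MvPolynomial.aeval_X _ _

theorem map_X_mul_derivative {R S : Type*} [CommRing R] [CommRing S] (f : R →+* S)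
    (y : PowerSeries R) :
    PowerSeries.X * PowerSeries.derivative S (PowerSeries.map f y) =
      PowerSeries.map f (PowerSeries.X * PowerSeries.derivative R y) := by
  ext1 n
  rw [coeff_X_mul_derivative, PowerSeries.coeff_map, PowerSeries.coeff_map, coeff_X_mul_derivative,
    map_nsmul]

/-- The substitution multiplies `H_δ(w)` by the scalar exponential `exp(ε δ ∑ (1 - t^k) (z w)^k /
k)`, which is the power `ε δ` of `(1 - t x) / (1 - x)` at `x = z w`. The sequence `a` is specified
by the Newton recursion of this factor, so that the cases `ε δ = 1` and `ε δ = -1` share one proof.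
-/
theorem shift_hRow {ε δ : F} {a : ℕ → F} (h0 : a 0 = 1)
    (ha : ∀ i : ℕ, (i : F) * a i =
      ε * δ * ∑ p ∈ Finset.HasAntidiagonal.antidiagonal i, (1 - t ^ p.1) * a p.2) (n : ℕ) :
    shift ε (hRow δ n) = ∑ p ∈ Finset.HasAntidiagonal.antidiagonal n,
      Polynomial.monomial p.1 (a p.1 • hRow δ p.2) := by
  set A : PowerSeries (Polynomial Lam) :=
    PowerSeries.mk fun i => Polynomial.monomial i (algebraMap F Lam (a i)) with hA
  set S : PowerSeries (Polynomial Lam) :=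
    PowerSeries.mk fun k => Polynomial.monomial k (algebraMap F Lam (ε * δ * (1 - t ^ k))) with hS
  have hT : PowerSeries.map (shift ε : Lam →+* Polynomial Lam) (pwSeries δ) =
      PowerSeries.map Polynomial.C (pwSeries δ) + S := by
    ext1 k
    rw [map_add, PowerSeries.coeff_map, PowerSeries.coeff_map, hS, PowerSeries.coeff_mk, pwSeries,
      PowerSeries.coeff_mk]
    rcases k with _ | k
    · simp
    · simp only [Nat.succ_ne_zero, if_false, scaledPw, pw, Nat.add_sub_cancel]
      rw [RingHom.coe_coe, map_smul, shift_X, smul_add, Polynomial.smul_monomial]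
      congr 1
      · rw [Polynomial.smul_C]
      · rw [Algebra.algebraMap_eq_smul_one, Algebra.algebraMap_eq_smul_one, smul_smul]
        congr 2
        ring
  have hAode : PowerSeries.X * PowerSeries.derivative (Polynomial Lam) A = S * A := by
    ext1 i
    rw [coeff_X_mul_derivative, PowerSeries.coeff_mul]
    simp only [hA, hS, PowerSeries.coeff_mk, Polynomial.monomial_mul_monomial]
    rw [Finset.sum_congr rfl (g := fun p => Polynomial.monomial i
      (algebraMap F Lam (ε * δ * ((1 - t ^ p.1) * a p.2))))]
    · rw [← map_sum, ← map_sum, ← Finset.mul_sum, ← ha, map_mul, map_natCast, ← nsmul_eq_mul,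
        map_nsmul]
    · intro p hp
      rw [Finset.HasAntidiagonal.mem_antidiagonal.1 hp, ← map_mul, mul_assoc]
  have key : PowerSeries.map (shift ε : Lam →+* Polynomial Lam) (hSeries δ) =
      A * PowerSeries.map Polynomial.C (hSeries δ) := by
    refine eq_of_logDerivative
      (C := PowerSeries.map (shift ε : Lam →+* Polynomial Lam) (pwSeries δ)) ?_ ?_ ?_ ?_
    · rw [← PowerSeries.coeff_zero_eq_constantCoeff_apply, PowerSeries.coeff_map,
        PowerSeries.coeff_zero_eq_constantCoeff_apply, constantCoeff_pwSeries, map_zero]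
    · rw [map_X_mul_derivative, hSeries_logDerivative, map_mul]
    · have h1 := map_X_mul_derivative (Polynomial.C : Lam →+* Polynomial Lam) (hSeries δ)
      rw [hSeries_logDerivative, map_mul] at h1
      rw [hT, derivative_mul_eq]
      linear_combination A * h1 + PowerSeries.map Polynomial.C (hSeries δ) * hAode
    · rw [map_mul, ← PowerSeries.coeff_zero_eq_constantCoeff_apply,
        ← PowerSeries.coeff_zero_eq_constantCoeff_apply,
        ← PowerSeries.coeff_zero_eq_constantCoeff_apply, PowerSeries.coeff_map,
        PowerSeries.coeff_map, hA, hSeries, PowerSeries.coeff_mk, PowerSeries.coeff_mk, hRow_zero,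
        h0]
      simp
  have h := congrArg (PowerSeries.coeff n) key
  rw [PowerSeries.coeff_map, PowerSeries.coeff_mul, hSeries, PowerSeries.coeff_mk] at h
  refine h.trans (Finset.sum_congr rfl fun p _ => ?_)
  rw [hA, PowerSeries.coeff_mk, PowerSeries.coeff_map, PowerSeries.coeff_mk,
    Polynomial.monomial_mul_C, Algebra.smul_def]

/-- The coefficient of `x ^ k` in `(1 - t x) / (1 - x)`. -/
def loweringCoeff (k : ℕ) : F := if k = 0 then 1 else 1 - t

/-- The logarithmic derivative `x y' / y` of `(1 - t x) / (1 - x)` is `∑ (1 - t^k) x^k`: the case `ε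
δ = 1` of `shift_hRow`. -/
theorem sum_one_sub_mul_loweringCoeff (i : ℕ) :
    (i : F) * loweringCoeff i = ∑ p ∈ Finset.HasAntidiagonal.antidiagonal i,
      (1 - t ^ p.1) * loweringCoeff p.2 := by
  rcases i with _ | i
  · simp
  rw [Finset.Nat.sum_antidiagonal_eq_sum_range_succ (fun k j => (1 - t ^ k) * loweringCoeff j),
    Finset.sum_range_succ]
  have : ∀ m i : ℕ, m ≤ i + 1 → ∑ k ∈ Finset.range m, (1 - t ^ k) * loweringCoeff (i + 1 - k) =
      m * (1 - t) - (1 - t ^ m) := by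
    intro m i
    induction m with
    | zero => simp
    | succ m ih =>
      intro hm
      rw [Finset.sum_range_succ, ih (by omega), loweringCoeff, if_neg (by omega)]
      push_cast
      ring
  rw [this _ _ le_rfl, loweringCoeff, loweringCoeff, if_neg (by omega), if_pos (by omega)]
  ring

/-- The reciprocal series `(1 - x) / (1 - t x)`, for `ε δ = -1`. This is how the raising operators
enter. -/
theorem sum_one_sub_mul_raisingCoeff (i : ℕ) :
    (i : F) * raisingCoeff i = -∑ p ∈ Finset.HasAntidiagonal.antidiagonal i,
      (1 - t ^ p.1) * raisingCoeff p.2 := by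
  rcases i with _ | i
  · simp
  have : ∀ i : ℕ, ∑ k ∈ Finset.range (i + 1), (1 - t ^ k) * raisingCoeff (i + 1 - k) =
      (t ^ i * (t - 1)) * (-i) + (t ^ (i + 1) - 1) + t ^ i * (1 - t) := by
    intro i
    rw [← Finset.sum_range_reflect]
    have h : ∀ k ∈ Finset.range (i + 1), (1 - t ^ (i + 1 - 1 - k)) *
        raisingCoeff (i + 1 - (i + 1 - 1 - k)) = (t - 1) * t ^ k - t ^ i * (t - 1) := by
      intro k hk
      rw [Finset.mem_range] at hk
      obtain ⟨j, rfl⟩ := Nat.exists_eq_add_of_le (Nat.lt_succ_iff.1 hk)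
      have h1 : k + j + 1 - 1 - k = j := by omega
      have h2 : k + j + 1 - j = k + 1 := by omega
      rw [h1, h2, raisingCoeff, if_neg (by omega), Nat.add_sub_cancel, pow_add]
      ring
    rw [Finset.sum_congr rfl h, Finset.sum_sub_distrib, ← Finset.mul_sum, mul_geom_sum,
      Finset.sum_const, Finset.card_range, nsmul_eq_mul]
    push_cast
    ring
  rw [Finset.Nat.sum_antidiagonal_eq_sum_range_succ (fun k j => (1 - t ^ k) * raisingCoeff j),
    Finset.sum_range_succ, this, raisingCoeff, raisingCoeff, if_neg (by omega), if_pos (by omega)]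
  push_cast
  ring

/-! ### The inner product and adjoint operators -/

/-- The norm `z_λ(t)` of a monomial in the power sums. -/
def normZ (d : ℕ →₀ ℕ) : F := d.prod fun k m => kap k ^ m * (m.factorial : F)

theorem normZ_ne_zero (d : ℕ →₀ ℕ) : normZ d ≠ 0 :=
  Finset.prod_ne_zero_iff.2 fun k _ =>
    mul_ne_zero (pow_ne_zero _ (kap_ne_zero k)) (by exact_mod_cast Nat.factorial_ne_zero _)

theorem normZ_add_single (d : ℕ →₀ ℕ) (k : ℕ) :
    normZ (Finsupp.single k 1 + d) = kap k * (d k + 1) * normZ d := by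
  have hs : ∀ e : ℕ →₀ ℕ, e.support ⊆ insert k d.support →
      normZ e = ∏ i ∈ insert k d.support, kap i ^ e i * ((e i).factorial : F) := fun e he =>
    Finsupp.prod_of_support_subset _ he _ (by simp)
  rw [hs d (Finset.subset_insert _ _), hs (Finsupp.single k 1 + d),
    ← Finset.mul_prod_erase _ _ (Finset.mem_insert_self k d.support),
    ← Finset.mul_prod_erase _ (fun i => kap i ^ d i * ((d i).factorial : F))
      (Finset.mem_insert_self k d.support)]
  · rw [Finset.prod_congr rfl (g := fun i => kap i ^ d i * ((d i).factorial : F))]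
    · rw [Finsupp.add_apply, Finsupp.single_eq_same, add_comm 1, pow_succ, Nat.factorial_succ]
      push_cast
      ring
    · intro i hi
      rw [Finsupp.add_apply, Finsupp.single_eq_of_ne (Finset.ne_of_mem_erase hi), zero_add]
  · intro i hi
    rw [Finset.mem_insert]
    by_cases h : i = k
    · exact Or.inl h
    · right
      rw [Finsupp.mem_support_iff] at hi ⊢
      rwa [Finsupp.add_apply, Finsupp.single_eq_of_ne h, zero_add] at hi

/-- The Hall–Littlewood inner product, for which the products of power sums are orthogonal with
norms `z_λ(t)`. -/
def pairing : Lam →ₗ[F] Lam →ₗ[F] F :=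
  (MvPolynomial.basisMonomials ℕ F).constr F fun d => normZ d • MvPolynomial.lcoeff F d

theorem pairing_monomial (d : ℕ →₀ ℕ) (c : F) (g : Lam) :
    pairing (MvPolynomial.monomial d c) g = c * (normZ d * g.coeff d) := by
  have h : MvPolynomial.monomial d c = c • MvPolynomial.basisMonomials ℕ F d := by
    rw [MvPolynomial.coe_basisMonomials, MvPolynomial.smul_monomial, smul_eq_mul, mul_one]
  rw [h, map_smul, pairing, Module.Basis.constr_basis]
  simp

theorem pairing_comm (f g : Lam) : pairing f g = pairing g f := by
  induction f using MvPolynomial.induction_on' with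
  | add p q hp hq => simp [hp, hq]
  | monomial d c =>
    induction g using MvPolynomial.induction_on' with
    | add p q hp hq => rw [map_add, map_add, hp, hq, LinearMap.add_apply]
    | monomial e c' =>
      rw [pairing_monomial, pairing_monomial, MvPolynomial.coeff_monomial,
        MvPolynomial.coeff_monomial]
      by_cases h : d = e
      · subst h; simp; ring
      · simp [h, Ne.symm h]

/-- One more factor `p_{k+1}` multiplies the norm by `kap k` times the new exponent, which is the
factor produced by `kap k • ∂`. -/
theorem pairing_X_mul (k : ℕ) (f g : Lam) :
    pairing (MvPolynomial.X k * f) g = pairing f (adj k g) := by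
  induction f using MvPolynomial.induction_on' with
  | add p q hp hq => rw [mul_add, map_add, map_add, LinearMap.add_apply, LinearMap.add_apply, hp, hq]
  | monomial d c =>
    rw [MvPolynomial.X, MvPolynomial.monomial_mul, one_mul, pairing_monomial, pairing_monomial,
      normZ_add_single, adj, Derivation.smul_apply, MvPolynomial.coeff_smul,
      MvPolynomial.coeff_pderiv, smul_eq_mul, add_comm d]
    ring

theorem pairing_X_mul_right (k : ℕ) (f g : Lam) :
    pairing f (MvPolynomial.X k * g) = pairing (adj k f) g := by
  rw [pairing_comm, pairing_X_mul, pairing_comm]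

theorem pairing_C (f : Lam) (c : F) : pairing f (MvPolynomial.C c) = c * f.coeff 0 := by
  rw [pairing_comm, MvPolynomial.C_apply, pairing_monomial]
  simp [normZ]

theorem eq_zero_of_pairing {g : Lam} (h : ∀ f, pairing f g = 0) : g = 0 := by
  ext d
  have := h (MvPolynomial.monomial d 1)
  rw [pairing_monomial, one_mul] at this
  simpa using (mul_eq_zero.1 this).resolve_left (normZ_ne_zero d)

theorem eq_of_pairing {g g' : Lam} (h : ∀ f, pairing f g = pairing f g') : g = g' :=
  sub_eq_zero.1 (eq_zero_of_pairing fun f => by rw [map_sub, h, sub_self])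

theorem coeff_zero_mul (f g : Lam) : (f * g).coeff 0 = f.coeff 0 * g.coeff 0 :=
  map_mul MvPolynomial.constantCoeff f g

theorem coeff_zero_hRow {ε : F} {n : ℕ} (hn : n ≠ 0) : (hRow ε n).coeff 0 = 0 := by
  have h := congrArg MvPolynomial.constantCoeff (nsmul_hRow ε n)
  rw [map_sum, Finset.sum_eq_zero, map_nsmul, nsmul_eq_mul] at h
  · exact (mul_eq_zero.1 h).resolve_left (by exact_mod_cast hn)
  · intro p _
    rw [map_mul]
    split_ifs
    · simp
    · simp [scaledPw, pw]

/-- The coefficient of `z ^ n` in the image under the substitution `p_k ↦ p_k + ε z ^ k`. -/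
def shiftCoeff (ε : F) (n : ℕ) : Lam →ₗ[F] Lam :=
  (Polynomial.lcoeff Lam n).restrictScalars F ∘ₗ (shift ε).toLinearMap

theorem shiftCoeff_apply (ε : F) (n : ℕ) (f : Lam) :
    shiftCoeff ε n f = (shift ε f).coeff n := rfl

theorem shiftCoeff_C (ε : F) (n : ℕ) (c : F) :
    shiftCoeff ε n (MvPolynomial.C c) = if n = 0 then MvPolynomial.C c else 0 := by
  rw [shiftCoeff_apply, ← MvPolynomial.algebraMap_eq, AlgHom.commutes,
    IsScalarTower.algebraMap_apply F Lam (Polynomial Lam), Polynomial.algebraMap_eq,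
    Polynomial.coeff_C]

theorem shiftCoeff_X_mul (ε : F) (n k : ℕ) (f : Lam) :
    shiftCoeff ε n (MvPolynomial.X k * f) = MvPolynomial.X k * shiftCoeff ε n f +
      if k + 1 ≤ n then ε • shiftCoeff ε (n - (k + 1)) f else 0 := by
  simp only [shiftCoeff_apply]
  rw [map_mul, shift_X, add_mul, Polynomial.coeff_add, Polynomial.coeff_C_mul,
    ← Polynomial.C_mul_X_pow_eq_monomial, mul_assoc, Polynomial.coeff_C_mul,
    Polynomial.coeff_X_pow_mul']
  split_ifs
  · rw [Algebra.smul_def]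
  · rw [mul_zero]

/-- By induction on `g`: moving a variable of `g` to the left as `adj k`, the Leibniz rule and
`adj_hRow` reproduce the recursion `shiftCoeff_X_mul`. -/
theorem pairing_hRow_mul (ε : F) (n : ℕ) (f g : Lam) :
    pairing (hRow ε n * f) g = pairing f (shiftCoeff ε n g) := by
  induction g using MvPolynomial.induction_on generalizing f n with
  | C c =>
    rw [shiftCoeff_C, pairing_C, coeff_zero_mul]
    split_ifs with h
    · rw [h, hRow_zero, pairing_C]; simp
    · rw [coeff_zero_hRow h]; simp
  | add p q hp hq => rw [map_add, map_add, map_add, hp, hq]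
  | mul_X g k ih =>
    rw [mul_comm g, pairing_X_mul_right, shiftCoeff_X_mul, map_add, pairing_X_mul_right, ← ih,
      Derivation.leibniz, smul_eq_mul, smul_eq_mul, map_add, LinearMap.add_apply, adj_hRow]
    congr 1
    split_ifs
    · rw [mul_smul_comm, map_smul, map_smul, ← ih, mul_comm f]; rfl
    · simp

/-- Adjoints of commuting multiplications commute. -/
theorem shiftCoeff_comm (ε δ : F) (m n : ℕ) (f : Lam) :
    shiftCoeff ε m (shiftCoeff δ n f) = shiftCoeff δ n (shiftCoeff ε m f) := by
  refine eq_of_pairing fun g => ?_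
  rw [← pairing_hRow_mul, ← pairing_hRow_mul, ← pairing_hRow_mul, ← pairing_hRow_mul,
    mul_left_comm]

theorem sum_shiftCoeff_shiftCoeff_neg (ε : F) (n : ℕ) (f : Lam) :
    ∑ p ∈ Finset.HasAntidiagonal.antidiagonal n, shiftCoeff ε p.1 (shiftCoeff (-ε) p.2 f) =
      if n = 0 then f else 0 := by
  refine eq_of_pairing fun g => ?_
  have h := congrArg (fun u => pairing (u * g) f) (sum_hRow_mul_hRow_neg ε n)
  simp only [Finset.sum_mul, map_sum, LinearMap.sum_apply] at h
  rw [map_sum]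
  refine (Finset.sum_congr rfl fun p _ => ?_).trans (h.trans ?_)
  · rw [← pairing_hRow_mul, ← pairing_hRow_mul, ← mul_assoc, mul_comm (hRow (-ε) p.2)]
  · split_ifs <;> simp

theorem exists_shiftCoeff_eq_zero (ε : F) (f : Lam) :
    ∃ N : ℕ, ∀ n, N ≤ n → shiftCoeff ε n f = 0 :=
  ⟨(shift ε f).natDegree + 1, fun _ hn => Polynomial.coeff_eq_zero_of_natDegree_lt hn⟩

/-! ### Rows with integer index -/

/-- `hRow` with an integer index. -/
def hInt (ε : F) (a : ℤ) : Lam := if 0 ≤ a then hRow ε a.toNat else 0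

theorem hInt_natCast (ε : F) (n : ℕ) : hInt ε n = hRow ε n := by simp [hInt]

theorem hInt_of_neg (ε : F) {a : ℤ} (ha : a < 0) : hInt ε a = 0 := if_neg (not_le.2 ha)

theorem shift_hInt {ε δ : F} {c : ℕ → F} (h0 : c 0 = 1)
    (hc : ∀ i : ℕ, (i : F) * c i =
      ε * δ * ∑ p ∈ Finset.HasAntidiagonal.antidiagonal i, (1 - t ^ p.1) * c p.2)
    (a : ℤ) (M : ℕ) (hM : a < M) :
    shift ε (hInt δ a) =
      ∑ i ∈ Finset.range M, Polynomial.monomial i (c i • hInt δ (a - i)) := by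
  rcases lt_or_ge a 0 with ha | ha
  · rw [hInt_of_neg _ ha, map_zero, Finset.sum_eq_zero]
    intro i _
    rw [hInt_of_neg _ (by omega), smul_zero, map_zero]
  · lift a to ℕ using ha
    rw [hInt_natCast, shift_hRow h0 hc,
      Finset.Nat.sum_antidiagonal_eq_sum_range_succ
        (fun i j => Polynomial.monomial i (c i • hRow δ j))]
    have hsub : Finset.range a.succ ⊆ Finset.range M := by
      intro i hi
      rw [Finset.mem_range] at *
      omega
    rw [← Finset.sum_subset hsub]
    · refine Finset.sum_congr rfl fun i hi => ?_
      rw [Finset.mem_range] at hi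
      rw [← hInt_natCast, Nat.cast_sub (by omega)]
    · intro i _ hi
      rw [Finset.mem_range] at hi
      rw [hInt_of_neg _ (by omega), smul_zero, map_zero]

/-- A coefficient of `H_1 H_{-1} = 1`. Nonzero terms need `-α ≤ s ≤ β`, so the finite window loses
nothing. -/
theorem sum_hInt_mul_hInt {α β : ℤ} {M : ℕ} (hα : α < M) (hβ : β < M) :
    ∑ s ∈ Finset.Ico (-(M : ℤ)) M, hInt 1 (α + s) * hInt (-1) (β - s) =
      if α + β = 0 then 1 else 0 := by
  rcases lt_or_ge (α + β) 0 with h | h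
  · rw [if_neg h.ne, Finset.sum_eq_zero]
    intro s _
    rcases lt_or_ge (α + s) 0 with h' | h'
    · rw [hInt_of_neg _ h', zero_mul]
    · rw [hInt_of_neg _ (a := β - s) (by omega), mul_zero]
  · obtain ⟨k, hk⟩ := Int.eq_ofNat_of_zero_le h
    have := sum_hRow_mul_hRow_neg 1 k
    have hk0 : α + β = 0 ↔ k = 0 := by rw [hk]; simp
    simp only [hk0]
    rw [← this]
    symm
    refine Finset.sum_of_injOn (fun p => (p.1 : ℤ) - α) ?_ ?_ ?_ ?_
    · rintro ⟨i, j⟩ hp ⟨i', j'⟩ hp' h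
      simp only [Finset.mem_coe, Finset.HasAntidiagonal.mem_antidiagonal] at hp hp' h
      ext <;> simp only <;> omega
    · rintro ⟨i, j⟩ hp
      simp only [Finset.mem_coe, Finset.HasAntidiagonal.mem_antidiagonal, Finset.mem_Ico] at hp ⊢
      omega
    · intro s _ hs
      rcases lt_or_ge (α + s) 0 with h' | h'
      · rw [hInt_of_neg _ h', zero_mul]
      · rcases lt_or_ge (β - s) 0 with h'' | h''
        · rw [hInt_of_neg _ h'', mul_zero]
        · refine absurd ⟨((α + s).toNat, (β - s).toNat), ?_, ?_⟩ hs
          · simp only [Finset.mem_coe, Finset.HasAntidiagonal.mem_antidiagonal]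
            omega
          · simp only
            omega
    · rintro ⟨i, j⟩ hp
      simp only [Finset.HasAntidiagonal.mem_antidiagonal] at hp
      simp only
      rw [← hInt_natCast, ← hInt_natCast]
      congr 2 <;> omega

/-! ### Vertex operators -/

/-- The linear map `∑ j, c_j z ^ j ↦ ∑ j, c_j φ_j`. -/
def contract (φ : ℕ → Lam) : Polynomial Lam →ₗ[Lam] Lam :=
  (Polynomial.basisMonomials Lam).constr Lam φ

theorem contract_monomial (φ : ℕ → Lam) (j : ℕ) (c : Lam) :
    contract φ (Polynomial.monomial j c) = c * φ j := by
  have h : Polynomial.monomial j c = c • Polynomial.basisMonomials Lam j := by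
    rw [Polynomial.coe_basisMonomials, Polynomial.smul_monomial, smul_eq_mul, mul_one]
  rw [h, map_smul, contract, Module.Basis.constr_basis, smul_eq_mul]

theorem contract_monomial_mul (φ : ℕ → Lam) (i : ℕ) (c : Lam) (P : Polynomial Lam) :
    contract φ (Polynomial.monomial i c * P) = c * contract (fun j => φ (i + j)) P := by
  induction P using Polynomial.induction_on' with
  | add p q hp hq => rw [mul_add, map_add, map_add, hp, hq, mul_add]
  | monomial j c' =>
    rw [Polynomial.monomial_mul_monomial, contract_monomial, contract_monomial, mul_assoc]

theorem contract_eq_sum (φ : ℕ → Lam) (P : Polynomial Lam) {N : ℕ}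
    (hN : ∀ n, N ≤ n → P.coeff n = 0) :
    contract φ P = ∑ j ∈ Finset.range N, P.coeff j * φ j := by
  have hP : P = ∑ j ∈ Finset.range N, Polynomial.monomial j (P.coeff j) := by
    ext1 n
    rw [Polynomial.finsetSum_coeff]
    simp only [Polynomial.coeff_monomial, Finset.sum_ite_eq', Finset.mem_range]
    split_ifs with h
    · rfl
    · exact hN n (not_lt.1 h)
  conv_lhs => rw [hP]
  rw [map_sum]
  exact Finset.sum_congr rfl fun j _ => contract_monomial φ j _

/-- The components of the vertex operator `exp (∑ ε (1 - t ^ k) / k p_k z ^ k) exp (-∑ ε z ^ {-k} ∂_k)`. -/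
def vertexOp (ε : F) (m : ℤ) : Lam →ₗ[F] Lam :=
  (contract fun j => hInt ε (m + j)).restrictScalars F ∘ₗ (shift (-ε)).toLinearMap

theorem vertexOp_apply (ε : F) (m : ℤ) (f : Lam) :
    vertexOp ε m f = contract (fun j => hInt ε (m + j)) (shift (-ε) f) := rfl

theorem vertexOp_eq_sum (ε : F) (m : ℤ) {f : Lam} {N : ℕ}
    (hN : ∀ n, N ≤ n → shiftCoeff (-ε) n f = 0) :
    vertexOp ε m f = ∑ j ∈ Finset.range N, shiftCoeff (-ε) j f * hInt ε (m + j) :=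
  contract_eq_sum _ _ hN

theorem vertexOp_hInt_mul {ε : F} (hε : ε * ε = 1) (a β : ℤ) (g : Lam) {M : ℕ} (hM : β < M) :
    vertexOp ε a (hInt (-ε) β * g) =
      ∑ i ∈ Finset.range M, loweringCoeff i • (hInt (-ε) (β - i) * vertexOp ε (a + i) g) := by
  rw [vertexOp_apply, map_mul, shift_hInt (c := loweringCoeff) (by simp [loweringCoeff]) _ β M hM,
    Finset.sum_mul, map_sum]
  · refine Finset.sum_congr rfl fun i _ => ?_
    rw [contract_monomial_mul, smul_mul_assoc, vertexOp_apply]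
    simp only [Nat.cast_add, add_assoc]
  · intro i
    rw [neg_mul_neg, hε, one_mul, sum_one_sub_mul_loweringCoeff]

/-- By `pairing_hRow_mul`, both sides become the sum over `A = m + j` of the inner products of the
`j`-th shift of `f` with the `A`-th shift of `g`. -/
theorem pairing_vertexOp (ε : F) (m : ℤ) (f g : Lam) :
    pairing (vertexOp ε m f) g = pairing f (vertexOp (-ε) (-m) g) := by
  obtain ⟨N₁, h₁⟩ := exists_shiftCoeff_eq_zero (-ε) f
  obtain ⟨N₂, h₂⟩ := exists_shiftCoeff_eq_zero ε g
  set N := N₁ + N₂ + m.natAbs with hN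
  have hf : ∀ n, N ≤ n → shiftCoeff (-ε) n f = 0 := fun n hn => h₁ n (by omega)
  have hg : ∀ n, N ≤ n → shiftCoeff (- -ε) n g = 0 := fun n hn => by
    rw [neg_neg]; exact h₂ n (by omega)
  rw [vertexOp_eq_sum ε m hf, vertexOp_eq_sum (-ε) (-m) hg, map_sum, map_sum,
    LinearMap.sum_apply]
  have hL : ∀ j ∈ Finset.range N, pairing (shiftCoeff (-ε) j f * hInt ε (m + j)) g =
      ∑ A ∈ Finset.range N, if (A : ℤ) = m + j then
        pairing (shiftCoeff (-ε) j f) (shiftCoeff ε A g) else 0 := by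
    intro j _
    rcases lt_or_ge (m + j) 0 with h | h
    · rw [hInt_of_neg _ h, Finset.sum_eq_zero]
      · simp
      · intro A _
        rw [if_neg (by omega)]
    · obtain ⟨A, hA⟩ := Int.eq_ofNat_of_zero_le h
      simp only [hA, Nat.cast_inj, Finset.sum_ite_eq', Finset.mem_range]
      rw [hInt_natCast, mul_comm, pairing_hRow_mul]
      split_ifs with h'
      · rfl
      · rw [h₂ A (by omega), map_zero]
  have hR : ∀ A ∈ Finset.range N, pairing f (shiftCoeff (- -ε) A g * hInt (-ε) (-m + A)) =
      ∑ j ∈ Finset.range N, if (A : ℤ) = m + j then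
        pairing (shiftCoeff (-ε) j f) (shiftCoeff ε A g) else 0 := by
    intro A _
    rw [neg_neg]
    rcases lt_or_ge (-m + A) 0 with h | h
    · rw [hInt_of_neg _ h, Finset.sum_eq_zero]
      · simp
      · intro j _
        rw [if_neg (by omega)]
    · obtain ⟨j, hj⟩ := Int.eq_ofNat_of_zero_le h
      have hiff : ∀ x : ℕ, ((A : ℤ) = m + x) ↔ x = j := fun x => by omega
      simp only [hiff, Finset.sum_ite_eq', Finset.mem_range]
      rw [hj, hInt_natCast, mul_comm, pairing_comm, pairing_hRow_mul, pairing_comm]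
      split_ifs with h'
      · rfl
      · rw [h₁ j (by omega), map_zero, LinearMap.zero_apply]
  rw [Finset.sum_congr rfl hL, Finset.sum_congr rfl hR, Finset.sum_comm]

/-! ### Normal ordering and the commutation rule -/

/-- The normally ordered product of two vertex operators, truncated at order `N`. -/
def normalOrder (N : ℕ) (ε : F) (a b : ℤ) (f : Lam) : Lam :=
  ∑ j ∈ Finset.range N, ∑ A ∈ Finset.range N,
    hInt (-ε) (b + j) * (hInt ε (a + A) * shiftCoeff (-ε) A (shiftCoeff ε j f))

/-- A bound from which on all double shifts of `f` vanish. -/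
def IsShiftBound (N : ℕ) (f : Lam) : Prop :=
  (∀ n, N ≤ n → shiftCoeff 1 n f = 0) ∧ ∀ n, N ≤ n → shiftCoeff (-1) n f = 0

theorem exists_isShiftBound (f : Lam) (m : ℕ) : ∃ N, m ≤ N ∧ IsShiftBound N f := by
  obtain ⟨N₁, h₁⟩ := exists_shiftCoeff_eq_zero 1 f
  obtain ⟨N₂, h₂⟩ := exists_shiftCoeff_eq_zero (-1) f
  exact ⟨N₁ + N₂ + m, by omega, fun n hn => h₁ n (by omega), fun n hn => h₂ n (by omega)⟩

/-- Moving the substitution of the outer operator past the multiplication of the inner one costs the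
factor `(1 - t x) / (1 - x)`, whose coefficients are the `loweringCoeff i`. -/
theorem vertexOp_vertexOp {ε : F} (hε : ε * ε = 1) (a b : ℤ) {f : Lam} {N : ℕ}
    (h₁ : ∀ n, N ≤ n → shiftCoeff ε n f = 0) (h₂ : ∀ n, N ≤ n → shiftCoeff (-ε) n f = 0)
    {M : ℕ} (hM : b + N < M) :
    vertexOp ε a (vertexOp (-ε) b f) =
      ∑ i ∈ Finset.range M, loweringCoeff i • normalOrder N ε (a + i) (b - i) f := by
  rw [vertexOp_eq_sum (-ε) b (by rwa [neg_neg]), neg_neg, map_sum,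
    Finset.sum_congr rfl fun j hj => by
      rw [mul_comm, vertexOp_hInt_mul hε a (b + j) _
        (M := M) (by have := Finset.mem_range.1 hj; omega)],
    Finset.sum_comm]
  refine Finset.sum_congr rfl fun i _ => ?_
  rw [← Finset.smul_sum, normalOrder]
  congr 1
  refine Finset.sum_congr rfl fun j _ => ?_
  rw [vertexOp_eq_sum ε (a + i) (N := N), Finset.mul_sum]
  · refine Finset.sum_congr rfl fun A _ => ?_
    rw [mul_comm (shiftCoeff (-ε) A _), show b + j - i = b - i + (j : ℤ) by ring]
  · intro n hn
    rw [shiftCoeff_comm, h₂ n hn, map_zero]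

theorem normalOrder_neg (N : ℕ) (ε : F) (a b : ℤ) (f : Lam) :
    normalOrder N (-ε) a b f = normalOrder N ε b a f := by
  rw [normalOrder, normalOrder, Finset.sum_comm]
  refine Finset.sum_congr rfl fun j _ => Finset.sum_congr rfl fun A _ => ?_
  rw [neg_neg, shiftCoeff_comm]
  ring

theorem normalOrder_eq_zero {N : ℕ} (ε : F) {a b : ℤ} (f : Lam) (h : a + N ≤ 0 ∨ b + N ≤ 0) :
    normalOrder N ε a b f = 0 := by
  refine Finset.sum_eq_zero fun j hj => Finset.sum_eq_zero fun A hA => ?_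
  rw [Finset.mem_range] at hj hA
  rcases h with h | h
  · rw [hInt_of_neg ε (by omega)]; simp
  · rw [hInt_of_neg (-ε) (by omega)]; simp

/-- Summing over `s` cancels the multiplications against each other since `H_1 H_{-1} = 1`. What
remains is a coefficient of the product of two mutually inverse shifts. -/
theorem sum_normalOrder {N M : ℕ} {n m : ℤ} (f : Lam) (hN : n - m < N)
    (hM : m + N < M) (hM' : -n + N < M) :
    ∑ s ∈ Finset.Ico (-(M : ℤ)) M, normalOrder N (-1) (-n - s) (m + s) f =
      if n = m then f else 0 := by
  simp only [normalOrder, neg_neg]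
  rw [Finset.sum_comm, Finset.sum_congr rfl fun j _ => Finset.sum_comm]
  have h1 : ∀ j ∈ Finset.range N, ∀ A ∈ Finset.range N,
      ∑ s ∈ Finset.Ico (-(M : ℤ)) M, hInt 1 (m + s + j) *
        (hInt (-1) (-n - s + A) * shiftCoeff 1 A (shiftCoeff (-1) j f)) =
      if (A : ℤ) + j = n - m then shiftCoeff 1 A (shiftCoeff (-1) j f) else 0 := by
    intro j hj A hA
    rw [Finset.mem_range] at hj hA
    have h := sum_hInt_mul_hInt (α := m + j) (β := -n + A) (M := M) (by omega) (by omega)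
    have hiff : ((m + j + (-n + A) : ℤ) = 0) ↔ (A : ℤ) + j = n - m := by omega
    simp only [hiff] at h
    have h' := congrArg (· * shiftCoeff 1 A (shiftCoeff (-1) j f)) h
    simp only [Finset.sum_mul, ite_mul, one_mul, zero_mul] at h'
    rw [← h']
    refine Finset.sum_congr rfl fun s _ => ?_
    rw [← mul_assoc]
    congr 3 <;> ring
  rw [Finset.sum_congr rfl fun j hj => Finset.sum_congr rfl (h1 j hj), Finset.sum_comm,
    ← Finset.sum_product', ← Finset.sum_filter]
  rcases lt_or_ge (n - m) 0 with h | h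
  · rw [Finset.filter_false_of_mem (fun p _ => by omega), Finset.sum_empty, if_neg (by omega)]
  · obtain ⟨k, hk⟩ := Int.eq_ofNat_of_zero_le h
    have hiff : n = m ↔ k = 0 := by omega
    simp only [hiff]
    rw [← sum_shiftCoeff_shiftCoeff_neg 1 k f]
    refine Finset.sum_congr ?_ fun _ _ => rfl
    ext p
    simp only [Finset.mem_filter, Finset.mem_product, Finset.mem_range,
      Finset.HasAntidiagonal.mem_antidiagonal]
    omega

theorem loweringCoeff_zero : loweringCoeff 0 = 1 := if_pos rfl

theorem sum_loweringCoeff_smul {V : Type*} [AddCommGroup V] [Module F V] (g : ℕ → V) (M : ℕ) :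
    ∑ i ∈ Finset.range (M + 1), loweringCoeff i • g i =
      (1 - t) • ∑ i ∈ Finset.range (M + 1), g i + t • g 0 := by
  have h : ∀ i ∈ Finset.range M, loweringCoeff (i + 1) • g (i + 1) = (1 - t) • g (i + 1) :=
    fun i _ => by simp [loweringCoeff]
  rw [Finset.sum_range_succ', Finset.sum_range_succ', loweringCoeff_zero, Finset.sum_congr rfl h,
    ← Finset.smul_sum, smul_add, add_assoc, ← add_smul, sub_add_cancel]

/-- A unitriangular system, solved downwards from the range where `g` vanishes. -/
theorem eq_zero_of_sum_loweringCoeff {V : Type*} [AddCommGroup V] [Module F V] {g : ℤ → V} {M : ℕ}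
    (h0 : ∀ s, (M : ℤ) ≤ s → g s = 0)
    (h1 : ∀ s, 0 < s → ∑ i ∈ Finset.range (M + 1), loweringCoeff i • g (s + i) = 0) :
    ∀ s, 0 < s → g s = 0 := by
  have key : ∀ k : ℕ, ∀ s, 0 < s → (M : ℤ) - k ≤ s → g s = 0 := by
    intro k
    induction k with
    | zero => intro s _ h; exact h0 s (by simpa using h)
    | succ k ih =>
      intro s hs hk
      have h := h1 s hs
      rw [Finset.sum_range_succ', Finset.sum_eq_zero, loweringCoeff_zero] at h
      · simpa using h
      · intro i _
        rw [ih (s + (i + 1 : ℕ)) (by omega) (by push_cast at *; omega), smul_zero]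
  intro s hs
  exact key M s hs (by omega)

/-- The creation operator `H_m`, which adds a row of length `m`. -/
abbrev creation (m : ℤ) : Lam →ₗ[F] Lam := vertexOp 1 m

/-- The annihilation operator, the adjoint of `creation m`. -/
abbrev annihilation (m : ℤ) : Lam →ₗ[F] Lam := vertexOp (-1) (-m)

theorem pairing_creation (m : ℤ) (f g : Lam) :
    pairing (creation m f) g = pairing f (annihilation m g) := pairing_vertexOp 1 m f g

/-- In terms of the normally ordered products `g s`, the two orders of the operators expand with the
same coefficients `1, 1 - t, 1 - t, …`, one towards positive and the other towards negative `s`. The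
assumption on `f` removes all `g s` with `s > 0`. Then `g 0` is creation after annihilation, and the
total of the remaining `g s` is `f` or `0`. -/
theorem annihilation_creation {n m : ℤ} (hmn : m ≤ n) {f : Lam}
    (hf : ∀ k, n < k → annihilation k f = 0) :
    annihilation n (creation m f) =
      t • creation m (annihilation n f) + if n = m then (1 - t) • f else 0 := by
  obtain ⟨N, hN, h₁, h₂⟩ := exists_isShiftBound f (n - m).natAbs.succ
  obtain ⟨M, hM⟩ : ∃ M : ℕ, M = N + n.natAbs + m.natAbs + 1 := ⟨_, rfl⟩
  set g : ℤ → Lam := fun s => normalOrder N (-1) (-n - s) (m + s) f with hg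
  have hup : ∀ s, (M : ℤ) ≤ s → g s = 0 := fun s hs =>
    normalOrder_eq_zero _ _ (Or.inl (by omega))
  have hlow : ∀ s, s ≤ -(M : ℤ) → g s = 0 := fun s hs =>
    normalOrder_eq_zero _ _ (Or.inr (by omega))
  have hCA : ∀ s, 0 ≤ s → creation (m + s) (annihilation (n + s) f) =
      ∑ i ∈ Finset.range (M + 1), loweringCoeff i • g (s + i) := by
    intro s hs
    rw [creation, annihilation,
      vertexOp_vertexOp (by ring) (m + s) (-(n + s)) h₁ h₂ (M := M + 1) (by push_cast; omega)]
    refine Finset.sum_congr rfl fun i _ => ?_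
    rw [hg, ← normalOrder_neg]
    congr 2 <;> ring
  have hAC : annihilation n (creation m f) =
      ∑ i ∈ Finset.range (M + 1), loweringCoeff i • g (-i) := by
    have h := vertexOp_vertexOp (ε := -1) (by ring) (-n) m h₂ (by rwa [neg_neg]) (M := M + 1)
      (by push_cast; omega)
    rw [neg_neg] at h
    rw [creation, annihilation, h]
    refine Finset.sum_congr rfl fun i _ => ?_
    rw [hg]
    congr 2; ring
  -- For `s > 0` the left side of `hCA s` vanishes by `hf`, which gives the triangular system.
  have hpos : ∀ s, 0 < s → g s = 0 := by
    refine eq_zero_of_sum_loweringCoeff hup fun s hs => ?_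
    rw [← hCA s hs.le, hf (n + s) (by omega), map_zero]
  have h0 : creation m (annihilation n f) = g 0 := by
    have h := hCA 0 le_rfl
    rw [add_zero, add_zero] at h
    rw [h, Finset.sum_range_succ', Finset.sum_eq_zero, loweringCoeff_zero]
    · simp
    · intro i _
      rw [hpos _ (by omega), smul_zero]
  have hsum : ∑ i ∈ Finset.range (M + 1), g (-i) = if n = m then f else 0 := by
    rw [← sum_normalOrder (N := N) (M := M + 1) f (by omega) (by push_cast; omega)
      (by push_cast; omega)]
    refine Finset.sum_of_injOn (fun i : ℕ => -(i : ℤ)) (fun i _ j _ h => by simpa using h) ?_ ?_ ?_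
    · intro i hi
      simp only [Finset.mem_coe, Finset.mem_range, Finset.mem_Ico] at hi ⊢
      omega
    · intro s hs hs'
      rcases lt_or_ge 0 s with h | h
      · exact hpos s h
      · rcases le_or_gt s (-(M : ℤ)) with h' | h'
        · exact hlow s h'
        · refine absurd ⟨(-s).toNat, ?_, ?_⟩ hs'
          · simp only [Finset.mem_coe, Finset.mem_range]
            omega
          · simp only; omega
    · intro i _
      rfl
  -- The coefficients `1, 1 - t, 1 - t, …` split as `1 - t` everywhere plus an extra `t` at index
  -- `0`.
  rw [hAC, sum_loweringCoeff_smul (fun i : ℕ => g (-i)), hsum, h0, Nat.cast_zero, neg_zero,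
    add_comm]
  split_ifs
  · rfl
  · rw [smul_zero]

theorem shiftCoeff_one (ε : F) {n : ℕ} (hn : n ≠ 0) : shiftCoeff ε n 1 = 0 := by
  have := shiftCoeff_C ε n 1
  rwa [if_neg hn, MvPolynomial.C_1] at this

theorem vertexOp_one (ε : F) (m : ℤ) : vertexOp ε m 1 = hInt ε m := by
  rw [vertexOp_eq_sum ε m (N := 1) fun n hn => shiftCoeff_one _ (by omega)]
  have := shiftCoeff_C (-ε) 0 1
  rw [if_pos rfl, MvPolynomial.C_1] at this
  simp [this]

theorem creation_zero_one : creation 0 1 = 1 := by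
  rw [creation, vertexOp_one, ← Nat.cast_zero, hInt_natCast, hRow_zero]

theorem annihilation_one {n : ℤ} (hn : 0 < n) : annihilation n 1 = 0 := by
  rw [annihilation, vertexOp_one, hInt_of_neg _ (by omega)]

/-! ### Orthogonality of the Hall–Littlewood functions -/

/-- The Hall–Littlewood function attached to a sequence of rows. -/
def rowQ : List ℕ → Lam
  | [] => 1
  | m :: l => creation m (rowQ l)

theorem rowQ_nil : rowQ [] = 1 := rfl

theorem rowQ_cons (m : ℕ) (l : List ℕ) : rowQ (m :: l) = creation m (rowQ l) := rfl

/-- The annihilator passes every smaller row without a delta term and finally kills `1`. The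
statement for all larger indices is needed at each passage, hence the induction generalizes `n`. -/
theorem annihilation_rowQ {n : ℤ} (hn : 0 < n) {l : List ℕ} (hl : ∀ x ∈ l, (x : ℤ) < n) :
    annihilation n (rowQ l) = 0 := by
  induction l generalizing n with
  | nil => exact annihilation_one hn
  | cons m l ih =>
    have hm := hl m List.mem_cons_self
    have hl' : ∀ x ∈ l, (x : ℤ) < n := fun x hx => hl x (List.mem_cons_of_mem m hx)
    rw [rowQ_cons, annihilation_creation hm.le, ih hn hl', map_zero, smul_zero, if_neg hm.ne', add_zero]
    intro k hk
    exact ih (by omega) fun x hx => (hl' x hx).trans hk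

/-- Each row equal to `n` contributes `1 - t` and passes the annihilator on with a factor `t`: `(1 -
t) + t (1 - t^c) = 1 - t^(c+1)`. -/
theorem annihilation_rowQ_cons {n : ℕ} (hn : 0 < n) {l : List ℕ}
    (hl : (n :: l).Pairwise (· ≥ ·)) :
    annihilation n (rowQ (n :: l)) = (1 - t ^ (l.count n + 1)) • rowQ l := by
  induction l with
  | nil =>
    rw [rowQ_cons, rowQ_nil, annihilation_creation le_rfl fun k hk => annihilation_one (by omega),
      annihilation_one (by omega)]
    simp
  | cons m l ih =>
    have hle := (List.pairwise_cons.1 hl).1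
    have hl' := (List.pairwise_cons.1 hl).2
    rw [rowQ_cons, annihilation_creation le_rfl fun k hk => annihilation_rowQ (by omega) fun x hx => by
      have := hle x hx; omega, if_pos rfl]
    rcases (hle m List.mem_cons_self).lt_or_eq with h | rfl
    · rw [annihilation_rowQ (by omega), List.count_eq_zero.2]
      · simp
      · intro hx
        rcases List.mem_cons.1 hx with rfl | hx
        · exact lt_irrefl _ h
        · have := (List.pairwise_cons.1 hl').1 _ hx
          omega
      · intro x hx
        rcases List.mem_cons.1 hx with rfl | hx
        · omega
        · have := (List.pairwise_cons.1 hl').1 _ hx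
          omega
    · rw [ih hl', map_smul, smul_smul, List.count_cons_self,
        show creation (m : ℤ) (rowQ l) = rowQ (m :: l) from rfl, ← add_smul]
      congr 1
      ring

/-- The scalar `b_s(t)` attached to a multiset of parts. -/
def bMul (s : Multiset ℕ) : F :=
  ∏ i ∈ s.toFinset, ∏ j ∈ Finset.Icc 1 (s.count i), (1 - t ^ j)

theorem bMul_ne_zero (s : Multiset ℕ) : bMul s ≠ 0 :=
  Finset.prod_ne_zero_iff.2 fun _ _ => Finset.prod_ne_zero_iff.2 fun j hj =>
    one_sub_t_pow_ne_zero (by have := (Finset.mem_Icc.1 hj).1; omega)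

theorem bMul_cons (k : ℕ) (s : Multiset ℕ) :
    bMul (k ::ₘ s) = (1 - t ^ (s.count k + 1)) * bMul s := by
  have h1 : bMul (k ::ₘ s) = ∏ i ∈ insert k s.toFinset,
      ∏ j ∈ Finset.Icc 1 ((k ::ₘ s).count i), (1 - t ^ j) := by
    rw [bMul, Multiset.toFinset_cons]
  have h2 : bMul s = ∏ i ∈ insert k s.toFinset, ∏ j ∈ Finset.Icc 1 (s.count i), (1 - t ^ j) := by
    rw [bMul]
    refine Finset.prod_subset (Finset.subset_insert _ _) fun i _ hi => ?_
    rw [Multiset.mem_toFinset] at hi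
    simp [Multiset.count_eq_zero_of_notMem hi]
  rw [h1, h2, ← Finset.mul_prod_erase _ (fun i => ∏ j ∈ Finset.Icc 1 ((k ::ₘ s).count i),
      (1 - t ^ j)) (Finset.mem_insert_self k s.toFinset),
    ← Finset.mul_prod_erase _ (fun i => ∏ j ∈ Finset.Icc 1 (s.count i), (1 - t ^ j))
      (Finset.mem_insert_self k s.toFinset)]
  have h3 : ∀ i ∈ (insert k s.toFinset).erase k,
      ∏ j ∈ Finset.Icc 1 ((k ::ₘ s).count i), (1 - t ^ j) =
        ∏ j ∈ Finset.Icc 1 (s.count i), (1 - t ^ j) := fun i hi => by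
    rw [Multiset.count_cons_of_ne (Finset.ne_of_mem_erase hi)]
  rw [Finset.prod_congr rfl h3, Multiset.count_cons_self, Finset.prod_Icc_succ_top (by omega)]
  ring

theorem pairing_one_one : pairing 1 1 = 1 := by
  rw [← MvPolynomial.C_1, pairing_C]
  simp

theorem pairing_rowQ_of_lt {m m' : ℕ} {l l' : List ℕ} (hl : (m :: l).Pairwise (· ≥ ·))
    (h : m < m') : pairing (rowQ (m' :: l')) (rowQ (m :: l)) = 0 := by
  rw [rowQ_cons, pairing_creation, annihilation_rowQ (by omega), map_zero]
  intro x hx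
  rcases List.mem_cons.1 hx with rfl | hx
  · omega
  · have := (List.pairwise_cons.1 hl).1 _ hx
    omega

/-- Move the larger first row to the other side as an annihilator. It gives zero unless the first
rows agree, and then one factor of `b` as in `bMul_cons`. -/
theorem pairing_rowQ {l l' : List ℕ} (hl : l.Pairwise (· ≥ ·)) (hl' : l'.Pairwise (· ≥ ·))
    (h0 : ∀ x ∈ l, 0 < x) (h0' : ∀ x ∈ l', 0 < x) :
    pairing (rowQ l) (rowQ l') = if l = l' then bMul l else 0 := by
  induction l generalizing l' with
  | nil =>
    cases l' with
    | nil => simp [rowQ, pairing_one_one, bMul]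
    | cons m' l' =>
      have := h0' m' List.mem_cons_self
      rw [pairing_comm, rowQ_cons, pairing_creation, rowQ_nil, annihilation_one (by omega)]
      simp
  | cons m l ih =>
    have hm := h0 m List.mem_cons_self
    cases l' with
    | nil =>
      rw [rowQ_cons, pairing_creation, rowQ_nil, annihilation_one (by omega)]
      simp
    | cons m' l' =>
      rcases lt_trichotomy m m' with h | rfl | h
      · rw [pairing_comm, pairing_rowQ_of_lt hl h, if_neg]
        simp [h.ne]
      · rw [pairing_comm, rowQ_cons, pairing_creation, annihilation_rowQ_cons hm hl, map_smul,
          pairing_comm, ih (List.pairwise_cons.1 hl).2 (List.pairwise_cons.1 hl').2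
            (fun x hx => h0 x (List.mem_cons_of_mem _ hx))
            fun x hx => h0' x (List.mem_cons_of_mem _ hx), ← Multiset.cons_coe, bMul_cons]
        simp
      · rw [pairing_rowQ_of_lt hl' h, if_neg]
        simp [h.ne']

/-! ### The grading and the basis in each degree -/

/-- The grading: `p_k` has degree `k`. -/
abbrev IsHom (n : ℤ) (f : Lam) : Prop :=
  MvPolynomial.IsWeightedHomogeneous (fun k : ℕ => (k : ℤ) + 1) f n

theorem isHom_one : IsHom 0 1 := MvPolynomial.isWeightedHomogeneous_one F _

theorem isHom_prod_map {s : Multiset ℕ} (hs : ∀ i ∈ s, 0 < i) {c : ℕ → Lam}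
    (hc : ∀ k : ℕ, 0 < k → IsHom k (c k)) : IsHom s.sum (s.map c).prod := by
  induction s using Multiset.induction with
  | empty => simpa using isHom_one
  | cons k s ih =>
    rw [Multiset.map_cons, Multiset.prod_cons, Multiset.sum_cons, Nat.cast_add]
    exact (hc k (hs k (Multiset.mem_cons_self k s))).mul
      (ih fun i hi => hs i (Multiset.mem_cons_of_mem hi))

theorem isHom_pw {k : ℕ} (hk : 0 < k) : IsHom k (pw k) := by
  have := MvPolynomial.isWeightedHomogeneous_X F (fun k : ℕ => (k : ℤ) + 1) (k - 1)
  rwa [Nat.cast_sub hk, Nat.cast_one, sub_add_cancel] at this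

theorem IsHom.smul {n : ℤ} {f : Lam} (c : F) (hf : IsHom n f) : IsHom n (c • f) :=
  (MvPolynomial.weightedHomogeneousSubmodule F (fun k : ℕ => (k : ℤ) + 1) n).smul_mem c hf

theorem isHom_sum {ι : Type*} {n : ℤ} {s : Finset ι} {f : ι → Lam} (h : ∀ i ∈ s, IsHom n (f i)) :
    IsHom n (∑ i ∈ s, f i) :=
  (MvPolynomial.weightedHomogeneousSubmodule F (fun k : ℕ => (k : ℤ) + 1) n).sum_mem h

theorem isHom_zero (n : ℤ) : IsHom n 0 := MvPolynomial.isWeightedHomogeneous_zero F _ n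

theorem isHom_hInt (ε : F) (a : ℤ) : IsHom a (hInt ε a) := by
  rw [hInt]
  split_ifs with h
  · lift a to ℕ using h
    rw [Int.toNat_natCast, hRow, completeSum]
    refine isHom_sum fun s hs => IsHom.smul _ ?_
    obtain ⟨h1, h2⟩ := mem_partitionFinset.1 hs
    rw [← h2]
    exact isHom_prod_map h1 fun k hk => (isHom_pw hk).smul _
  · exact isHom_zero a

theorem pairing_eq_zero_of_isHom {a b : ℤ} (hab : a ≠ b) {f g : Lam} (hf : IsHom a f)
    (hg : IsHom b g) : pairing f g = 0 := by
  rw [f.as_sum, map_sum, LinearMap.sum_apply]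
  refine Finset.sum_eq_zero fun d hd => ?_
  rw [pairing_monomial]
  by_cases h : g.coeff d = 0
  · rw [h, mul_zero, mul_zero]
  · exact absurd ((hf (MvPolynomial.mem_support_iff.1 hd)).symm.trans (hg h)) hab

theorem isHom_monomial (d : ℕ →₀ ℕ) (c : F) :
    IsHom (Finsupp.weight (fun k : ℕ => (k : ℤ) + 1) d) (MvPolynomial.monomial d c) :=
  MvPolynomial.isWeightedHomogeneous_monomial _ _ _ rfl

/-- Adjoint to multiplication by an element of degree `A`; different degrees are orthogonal. -/
theorem IsHom.shiftCoeff {n : ℤ} {f : Lam} (hf : IsHom n f) (ε : F) (A : ℕ) :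
    IsHom (n - A) (shiftCoeff ε A f) := by
  intro d hd
  by_contra hne
  refine hd ?_
  have h1 := pairing_monomial d 1 (Green.shiftCoeff ε A f)
  have h2 := isHom_hInt ε A
  rw [hInt_natCast] at h2
  rw [← pairing_hRow_mul, pairing_eq_zero_of_isHom _ (h2.mul (isHom_monomial d 1)) hf] at h1
  · rw [one_mul] at h1
    exact (mul_eq_zero.1 h1.symm).resolve_left (normZ_ne_zero d)
  · intro h
    exact hne (by rw [← h]; ring)

theorem IsHom.vertexOp {n : ℤ} {f : Lam} (hf : IsHom n f) (ε : F) (m : ℤ) :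
    IsHom (n + m) (vertexOp ε m f) := by
  obtain ⟨N, hN⟩ := exists_shiftCoeff_eq_zero (-ε) f
  rw [vertexOp_eq_sum ε m hN]
  refine isHom_sum fun j _ => ?_
  have := (hf.shiftCoeff (-ε) j).mul (isHom_hInt ε (m + j))
  rwa [show n - j + (m + j) = n + m by ring] at this

theorem isHom_rowQ (l : List ℕ) : IsHom l.sum (rowQ l) := by
  induction l with
  | nil => exact isHom_one
  | cons m l ih =>
    rw [List.sum_cons, Nat.cast_add, add_comm]
    exact ih.vertexOp 1 m

/-- The product of the power sums indexed by the parts of `s`. -/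
def pwMul (s : Multiset ℕ) : Lam := (s.map pw).prod

theorem monomial_eq_pwMul (d : ℕ →₀ ℕ) :
    MvPolynomial.monomial d (1 : F) = pwMul ((Finsupp.toMultiset d).map (· + 1)) := by
  induction d using Finsupp.induction_linear with
  | zero => simp [pwMul]
  | add d e hd he =>
    rw [← one_mul (1 : F), ← MvPolynomial.monomial_mul, hd, he, pwMul, pwMul, pwMul, map_add,
      Multiset.map_add, Multiset.map_add, Multiset.prod_add]
  | single k n =>
    rw [← MvPolynomial.X_pow_eq_monomial, Finsupp.toMultiset_single, Multiset.map_nsmul, pwMul,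
      Multiset.map_nsmul, Multiset.prod_nsmul]
    simp [pw]

theorem sum_toMultiset_map_succ (d : ℕ →₀ ℕ) :
    ((((Finsupp.toMultiset d).map (· + 1)).sum : ℕ) : ℤ) =
      Finsupp.weight (fun k : ℕ => (k : ℤ) + 1) d := by
  induction d using Finsupp.induction_linear with
  | zero => simp
  | add d e hd he => rw [map_add, map_add, Multiset.map_add, Multiset.sum_add, Nat.cast_add, hd, he]
  | single k n =>
    rw [Finsupp.toMultiset_single, Multiset.map_nsmul, Multiset.sum_nsmul, Finsupp.weight_single]
    simp

theorem IsHom.mem_span_pwMul {n : ℕ} {f : Lam} (hf : IsHom n f) :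
    f ∈ Submodule.span F (Set.range fun r : n.Partition => pwMul r.parts) := by
  rw [f.as_sum]
  refine Submodule.sum_mem _ fun d hd => ?_
  have hw := hf (MvPolynomial.mem_support_iff.1 hd)
  have hm : MvPolynomial.monomial d (f.coeff d) =
      f.coeff d • pwMul ((Finsupp.toMultiset d).map (· + 1)) := by
    rw [← monomial_eq_pwMul, MvPolynomial.smul_monomial, smul_eq_mul, mul_one]
  rw [← sum_toMultiset_map_succ, Nat.cast_inj] at hw
  rw [hm]
  refine Submodule.smul_mem _ _ (Submodule.subset_span
    ⟨⟨(Finsupp.toMultiset d).map (· + 1), fun {i} hi => ?_, hw⟩, rfl⟩)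
  obtain ⟨j, -, rfl⟩ := Multiset.mem_map.1 hi
  exact Nat.succ_pos j

theorem coe_rows {n : ℕ} (lam : n.Partition) : (rows lam : Multiset ℕ) = lam.parts :=
  Multiset.sort_eq _ _

theorem pairwise_rows {n : ℕ} (lam : n.Partition) : (rows lam).Pairwise (· ≥ ·) :=
  Multiset.pairwise_sort _ _

theorem pos_of_mem_rows {n : ℕ} (lam : n.Partition) : ∀ x ∈ rows lam, 0 < x := fun _ hx =>
  lam.parts_pos ((Multiset.mem_sort _).1 hx)

theorem rows_injective {m n : ℕ} {lam : m.Partition} {mu : n.Partition} (h : rows lam = rows mu) :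
    (⟨m, lam⟩ : Σ k : ℕ, k.Partition) = ⟨n, mu⟩ := by
  have hp : lam.parts = mu.parts := by rw [← coe_rows, ← coe_rows, h]
  obtain rfl : m = n := by rw [← lam.parts_sum, ← mu.parts_sum, hp]
  rw [Nat.Partition.ext hp]

theorem pairing_rowQ_rows (lam mu : Σ k : ℕ, k.Partition) :
    pairing (rowQ (rows lam.2)) (rowQ (rows mu.2)) = if lam = mu then b lam.2 else 0 := by
  rw [pairing_rowQ (pairwise_rows _) (pairwise_rows _) (pos_of_mem_rows _) (pos_of_mem_rows _),
    coe_rows]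
  by_cases h : lam = mu
  · subst h; rw [if_pos rfl, if_pos rfl]; rfl
  · rw [if_neg h, if_neg fun h' => h (rows_injective h')]

theorem b_ne_zero {n : ℕ} (lam : n.Partition) : b lam ≠ 0 := bMul_ne_zero _

theorem sum_rows {n : ℕ} (lam : n.Partition) : (rows lam).sum = n := by
  rw [← Multiset.sum_coe, coe_rows, lam.parts_sum]

theorem linearIndependent_rowQ (n : ℕ) :
    LinearIndependent F fun lam : n.Partition => rowQ (rows lam) := by
  rw [Fintype.linearIndependent_iff]
  intro g hg lam
  have h := congrArg (fun f => pairing f (rowQ (rows lam))) hg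
  simp only [map_sum, map_smul, LinearMap.sum_apply, LinearMap.smul_apply, smul_eq_mul, map_zero,
    LinearMap.zero_apply] at h
  rw [Finset.sum_eq_single lam] at h
  · have h2 := pairing_rowQ_rows ⟨n, lam⟩ ⟨n, lam⟩
    rw [if_pos rfl] at h2
    rw [h2] at h
    exact (mul_eq_zero.1 h).resolve_right (b_ne_zero lam)
  · intro nu _ hne
    have h2 := pairing_rowQ_rows ⟨n, nu⟩ ⟨n, lam⟩
    rw [if_neg (by simpa using hne)] at h2
    rw [h2, mul_zero]
  · simp

/-- By homogeneity one span lies in the other. Both families are indexed by the partitions of `n`,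
and the left one is independent, so the dimensions force equality. -/
theorem span_rowQ (n : ℕ) :
    Submodule.span F (Set.range fun lam : n.Partition => rowQ (rows lam)) =
      Submodule.span F (Set.range fun r : n.Partition => pwMul r.parts) := by
  have := FiniteDimensional.span_of_finite F
    (Set.finite_range fun r : n.Partition => pwMul r.parts)
  refine Submodule.eq_of_le_of_finrank_le ?_ ?_
  · rw [Submodule.span_le]
    rintro _ ⟨lam, rfl⟩
    have := isHom_rowQ (rows lam)
    rw [sum_rows] at this
    exact this.mem_span_pwMul
  · rw [finrank_span_eq_card (linearIndependent_rowQ n)]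
    exact finrank_range_le_card _

/-- The expansion of a power sum product in the Hall–Littlewood functions. -/
theorem pwMul_eq_sum {n : ℕ} (mu : n.Partition) : pwMul mu.parts =
    ∑ nu : n.Partition, pairing (pwMul mu.parts) (rowQ (rows nu)) • (b nu)⁻¹ • rowQ (rows nu) := by
  have h : pwMul mu.parts ∈
      Submodule.span F (Set.range fun lam : n.Partition => rowQ (rows lam)) := by
    rw [span_rowQ]
    exact Submodule.subset_span ⟨mu, rfl⟩
  obtain ⟨c, hc⟩ := (Submodule.mem_span_range_iff_exists_fun F).1 h
  have hcoef : ∀ nu : n.Partition, pairing (pwMul mu.parts) (rowQ (rows nu)) = c nu * b nu := by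
    intro nu
    rw [← hc, map_sum, LinearMap.sum_apply, Finset.sum_eq_single nu]
    · have h2 := pairing_rowQ_rows ⟨n, nu⟩ ⟨n, nu⟩
      rw [if_pos rfl] at h2
      rw [map_smul, LinearMap.smul_apply, h2, smul_eq_mul]
    · intro lam _ hne
      have h2 := pairing_rowQ_rows ⟨n, lam⟩ ⟨n, nu⟩
      rw [if_neg (by simpa using hne)] at h2
      rw [map_smul, LinearMap.smul_apply, h2, smul_zero]
    · simp
  rw [← hc]
  refine Finset.sum_congr rfl fun nu _ => ?_
  rw [hc, hcoef, smul_smul, mul_assoc, mul_inv_cancel₀ (b_ne_zero nu), mul_one]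

/-! ### Realization in power series -/

/-- The realization of symmetric functions as formal power series. -/
def toSeries : Lam →ₐ[F] Series := MvPolynomial.aeval fun k => powerSum (k + 1)

theorem toSeries_X (k : ℕ) : toSeries (MvPolynomial.X k) = powerSum (k + 1) :=
  MvPolynomial.aeval_X _ _

theorem coeff_powerSum_mul {k : ℕ} (hk : k ≠ 0) (d : ℕ →₀ ℕ) (g : Series) :
    MvPowerSeries.coeff d (powerSum k * g) = ∑ i ∈ d.support,
      if k ≤ d i then MvPowerSeries.coeff (d - Finsupp.single i k) g else 0 := by
  classical
  have hps : ∀ e : ℕ →₀ ℕ, MvPowerSeries.coeff e (powerSum k) =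
      if ∃ i : ℕ, e = Finsupp.single i k then 1 else 0 := fun e => by
    rw [MvPowerSeries.coeff_apply, powerSum]
  rw [MvPowerSeries.coeff_mul, ← Finset.sum_filter]
  symm
  refine Finset.sum_of_injOn (fun i => (Finsupp.single i k, d - Finsupp.single i k)) ?_ ?_ ?_ ?_
  · intro i _ j _ h
    exact Finsupp.single_left_injective hk (Prod.ext_iff.1 h).1
  · intro i hi
    simp only [Finset.mem_coe, Finset.mem_filter] at hi
    simp only [Finset.mem_coe, Finset.HasAntidiagonal.mem_antidiagonal]
    exact add_tsub_cancel_of_le (Finsupp.single_le_iff.2 hi.2)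
  · rintro ⟨e, e'⟩ he hne
    rw [Finset.HasAntidiagonal.mem_antidiagonal] at he
    rw [hps, if_neg, zero_mul]
    rintro ⟨i, rfl⟩
    simp only at he
    have hle : k ≤ d i := by rw [← he]; simp
    refine hne ⟨i, ?_, ?_⟩
    · simp only [Finset.mem_coe, Finset.mem_filter, Finsupp.mem_support_iff]
      omega
    · rw [← he]; simp
  · intro i _
    rw [hps, if_pos ⟨i, rfl⟩, one_mul]

/-- The product of the `q_{d_i}`. -/
def qProd (d : ℕ →₀ ℕ) : Lam := d.prod fun _ n => hRow 1 n

theorem qProd_eq_prod {d : ℕ →₀ ℕ} {s : Finset ℕ} (h : d.support ⊆ s) :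
    qProd d = ∏ i ∈ s, hRow 1 (d i) :=
  Finsupp.prod_of_support_subset _ h _ fun _ _ => hRow_zero 1

theorem derivation_prod (D : Derivation F Lam Lam) (s : Finset ℕ) (f : ℕ → Lam) :
    D (∏ i ∈ s, f i) = ∑ i ∈ s, D (f i) * ∏ j ∈ s.erase i, f j := by
  induction s using Finset.induction_on with
  | empty => simp
  | insert a s ha ih =>
    rw [Finset.prod_insert ha, Finset.sum_insert ha, Derivation.leibniz, ih, smul_eq_mul,
      smul_eq_mul, Finset.erase_insert ha, add_comm, mul_comm, Finset.mul_sum]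
    congr 1
    refine Finset.sum_congr rfl fun i hi => ?_
    have hne : a ≠ i := fun h => ha (h ▸ hi)
    rw [Finset.erase_insert_of_ne hne, Finset.prod_insert fun h => ha (Finset.mem_of_mem_erase h)]
    ring

theorem adj_qProd (k : ℕ) (d : ℕ →₀ ℕ) : adj k (qProd d) = ∑ i ∈ d.support,
    if k + 1 ≤ d i then qProd (d - Finsupp.single i (k + 1)) else 0 := by
  rw [qProd_eq_prod subset_rfl, derivation_prod]
  refine Finset.sum_congr rfl fun i hi => ?_
  rw [adj_hRow, one_smul, ite_zero_mul,
    qProd_eq_prod (Finsupp.support_mono (tsub_le_self : d - Finsupp.single i (k + 1) ≤ d)),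
    ← Finset.mul_prod_erase _ _ hi, Finsupp.tsub_apply, Finsupp.single_eq_same]
  rw [Finset.prod_congr rfl (g := fun j => hRow 1 ((d - Finsupp.single i (k + 1)) j))]
  intro j hj
  rw [Finsupp.tsub_apply, Finsupp.single_eq_of_ne (Finset.ne_of_mem_erase hj), tsub_zero]

theorem coeff_zero_qProd {d : ℕ →₀ ℕ} (hd : d ≠ 0) : (qProd d).coeff 0 = 0 := by
  obtain ⟨i, hi⟩ := Finsupp.support_nonempty_iff.2 hd
  rw [qProd_eq_prod subset_rfl, ← Finset.mul_prod_erase _ _ hi, coeff_zero_mul,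
    coeff_zero_hRow (Finsupp.mem_support_iff.1 hi), zero_mul]

/-- Both sides obey the same recursion under multiplication of `f` by a power sum: lowering one
exponent of the monomial on the left, the Leibniz rule for `adj` on the product of the `q_{d_i}` on
the right. -/
theorem coeff_toSeries (d : ℕ →₀ ℕ) (f : Lam) :
    MvPowerSeries.coeff d (toSeries f) = pairing (qProd d) f := by
  classical
  induction f using MvPolynomial.induction_on generalizing d with
  | C c =>
    rw [← MvPolynomial.algebraMap_eq, AlgHom.commutes, MvPolynomial.algebraMap_eq, pairing_C,
      MvPowerSeries.algebraMap_apply, Algebra.algebraMap_self, RingHom.id_apply,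
      MvPowerSeries.coeff_C]
    split_ifs with h
    · rw [h]; simp [qProd]
    · rw [coeff_zero_qProd h, mul_zero]
  | add p q hp hq => rw [map_add, map_add, map_add, hp, hq]
  | mul_X g k ih =>
    rw [mul_comm, map_mul, toSeries_X, coeff_powerSum_mul (Nat.succ_ne_zero k),
      pairing_X_mul_right, adj_qProd, map_sum, LinearMap.sum_apply]
    refine Finset.sum_congr rfl fun i _ => ?_
    split_ifs
    · exact ih _
    · simp

theorem exists_qProd_of_mem_closure {x : Lam} (hx : x ∈ Submonoid.closure (Set.range (hRow 1))) :
    ∃ d, x = qProd d := by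
  induction hx using Submonoid.closure_induction_left with
  | one => exact ⟨0, by simp [qProd]⟩
  | mul_left x hx y _ ih =>
    obtain ⟨n, rfl⟩ := hx
    obtain ⟨d, rfl⟩ := ih
    -- A fresh variable carries the new factor, so repeated factors `q_n` cause no collision.
    obtain ⟨j, hj⟩ := Infinite.exists_notMem_finset d.support
    refine ⟨Finsupp.single j n + d, ?_⟩
    rw [qProd, qProd, Finsupp.prod_add_index_of_disjoint, Finsupp.prod_single_index]
    · exact hRow_zero 1
    · refine Finset.disjoint_of_subset_left Finsupp.support_single_subset ?_
      rwa [Finset.disjoint_singleton_left]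

theorem adjoin_hRow : Algebra.adjoin F (Set.range (hRow 1)) = ⊤ := by
  rw [eq_top_iff, ← MvPolynomial.adjoin_range_X]
  refine Algebra.adjoin_le ?_
  rintro _ ⟨k, rfl⟩
  have hh : ∀ n, hRow 1 n ∈ Algebra.adjoin F (Set.range (hRow 1)) := fun n =>
    Algebra.subset_adjoin ⟨n, rfl⟩
  induction k using Nat.strong_induction_on with
  | _ k ih =>
    have h := nsmul_hRow 1 (k + 1)
    have hmem : (k + 1, 0) ∈ Finset.HasAntidiagonal.antidiagonal (k + 1) :=
      Finset.HasAntidiagonal.mem_antidiagonal.2 rfl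
    rw [← Finset.add_sum_erase _ _ hmem] at h
    simp only at h
    rw [hRow_zero, mul_one, if_neg (by simp),
      scaledPw, pw, Nat.add_sub_cancel, one_mul] at h
    have h2 : (1 - t ^ (k + 1)) • (MvPolynomial.X k : Lam) ∈
        Algebra.adjoin F (Set.range (hRow 1)) := by
      -- Newton's identity solved for its top power sum; all other terms involve smaller ones.
      rw [eq_sub_iff_add_eq.2 h.symm]
      refine sub_mem (nsmul_mem (hh _) _) (sum_mem fun p hp => mul_mem ?_ (hh _))
      rw [Finset.mem_erase, Finset.HasAntidiagonal.mem_antidiagonal] at hp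
      split_ifs with h0
      · exact zero_mem _
      · refine Subalgebra.smul_mem _ (ih (p.1 - 1) ?_) _
        have : p.1 ≠ k + 1 := fun h1 => hp.1 (Prod.ext h1 (by simp only; omega))
        omega
    have h3 := Subalgebra.smul_mem _ h2 (1 - t ^ (k + 1))⁻¹
    rwa [smul_smul, inv_mul_cancel₀ (one_sub_t_pow_ne_zero (Nat.succ_ne_zero k)), one_smul] at h3

theorem toSeries_injective : Function.Injective toSeries := by
  rw [injective_iff_map_eq_zero]
  intro f hf
  refine eq_zero_of_pairing fun g => ?_
  have hg : g ∈ Algebra.adjoin F (Set.range (hRow 1)) := by rw [adjoin_hRow]; trivial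
  rw [← Subalgebra.mem_toSubmodule, Algebra.adjoin_eq_span] at hg
  induction hg using Submodule.span_induction with
  | mem x hx =>
    obtain ⟨d, rfl⟩ := exists_qProd_of_mem_closure hx
    rw [← coeff_toSeries, hf, map_zero]
  | zero => simp
  | add x y _ _ hx hy => rw [map_add, LinearMap.add_apply, hx, hy, add_zero]
  | smul c x _ hx => rw [map_smul, LinearMap.smul_apply, hx, smul_zero]

theorem prod_map_scaledPw (ε : F) (s : Multiset ℕ) : (s.map (scaledPw ε)).prod =
    (ε ^ s.card * (s.map fun i => 1 - t ^ i).prod) • pwMul s := by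
  induction s using Multiset.induction with
  | empty => simp [pwMul]
  | cons k s ih =>
    rw [Multiset.map_cons, Multiset.prod_cons, ih, scaledPw, smul_mul_smul_comm, pwMul, pwMul,
      Multiset.map_cons, Multiset.prod_cons, Multiset.map_cons, Multiset.prod_cons,
      Multiset.card_cons]
    congr 1
    ring

theorem hRow_eq_sum (ε : F) (n : ℕ) :
    hRow ε n = ∑ rho : n.Partition, (ε ^ rho.parts.card / z rho) • pwMul rho.parts := by
  rw [hRow, completeSum, sum_partitionFinset]
  refine Finset.sum_congr rfl fun rho _ => ?_
  rw [prod_map_scaledPw, smul_smul, z]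
  congr 1
  have : (zMul rho.parts : F) = (zNum rho : F) := rfl
  rw [this, div_div_eq_mul_div, div_eq_mul_inv]
  ring

theorem toSeries_pwMul {n : ℕ} (mu : n.Partition) : toSeries (pwMul mu.parts) = powerSumPart mu := by
  rw [pwMul, map_multiset_prod, powerSumPart, Multiset.map_map]
  congr 1
  refine Multiset.map_congr rfl fun k hk => ?_
  have := mu.parts_pos hk
  rw [Function.comp_apply, pw, toSeries_X, Nat.sub_add_cancel this]

theorem toSeries_hInt (a : ℤ) : toSeries (hInt 1 a) = q a := by
  rw [hInt, q]
  split_ifs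
  · rw [hRow_eq_sum, map_sum, qNat]
    refine Finset.sum_congr rfl fun rho _ => ?_
    rw [map_smul, toSeries_pwMul, one_pow, one_div]
  · exact map_zero _

/-! ### Raising operators as creation operators -/

/-- A pair of positions in a sequence of length `l + 1` either avoids the first position or
contains it. -/
def pairsSucc (l : ℕ) : Pairs l ⊕ Fin l → Pairs (l + 1) :=
  Sum.elim (fun p => ⟨(p.1.1.succ, p.1.2.succ), Fin.succ_lt_succ_iff.2 p.2⟩)
    fun j => ⟨(0, j.succ), Fin.succ_pos j⟩

theorem pairsSucc_bijective (l : ℕ) : Function.Bijective (pairsSucc l) := by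
  constructor
  · rintro (⟨⟨a, b⟩, h⟩ | j) (⟨⟨a', b'⟩, h'⟩ | j') heq
    · simpa [pairsSucc] using heq
    · exact absurd (congrArg (fun p => p.1.1) heq) (Fin.succ_ne_zero a)
    · exact absurd (congrArg (fun p => p.1.1) heq).symm (Fin.succ_ne_zero a')
    · simpa [pairsSucc] using heq
  · rintro ⟨⟨a, b⟩, h⟩
    induction b using Fin.cases with
    | zero => exact absurd h (Fin.not_lt_zero a)
    | succ b =>
      induction a using Fin.cases with
      | zero => exact ⟨Sum.inr b, rfl⟩
      | succ a => exact ⟨Sum.inl ⟨(a, b), Fin.succ_lt_succ_iff.1 h⟩, rfl⟩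

/-- Exponents of the raising operators for `l + 1` positions. -/
def exponentEquiv (l : ℕ) : (Pairs l → ℕ) × (Fin l → ℕ) ≃ (Pairs (l + 1) → ℕ) :=
  (Equiv.sumArrowEquivProdArrow _ _ _).symm.trans
    ((Equiv.ofBijective _ (pairsSucc_bijective l)).arrowCongr (Equiv.refl ℕ))

theorem exponentEquiv_pairsSucc {l : ℕ} (K : Pairs l → ℕ) (k : Fin l → ℕ) (x : Pairs l ⊕ Fin l) :
    exponentEquiv l (K, k) (pairsSucc l x) = Sum.elim K k x := by
  have h : (Equiv.ofBijective _ (pairsSucc_bijective l)).symm (pairsSucc l x) = x :=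
    Equiv.ofBijective_symm_apply_apply _ _ x
  simp only [exponentEquiv, Equiv.trans_apply, Equiv.arrowCongr_apply, Function.comp_apply, h]
  rfl

theorem sum_pairs_succ {l : ℕ} {M : Type*} [AddCommMonoid M] (g : Pairs (l + 1) → M) :
    ∑ p, g p = ∑ p, g (pairsSucc l (Sum.inl p)) + ∑ j, g (pairsSucc l (Sum.inr j)) := by
  rw [← Fintype.sum_sum_type fun x => g (pairsSucc l x)]
  exact ((pairsSucc_bijective l).sum_comp g).symm

theorem prod_pairs_succ {l : ℕ} {M : Type*} [CommMonoid M] (g : Pairs (l + 1) → M) :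
    ∏ p, g p = (∏ p, g (pairsSucc l (Sum.inl p))) * ∏ j, g (pairsSucc l (Sum.inr j)) := by
  rw [← Fintype.prod_sum_type fun x => g (pairsSucc l x)]
  exact ((pairsSucc_bijective l).prod_comp g).symm

theorem raise_apply {l : ℕ} (K : Pairs l → ℕ) (alpha : Fin l → ℤ) (i : Fin l) :
    raise K alpha i = alpha i + ∑ p : Pairs l, (K p : ℤ) *
      ((if i = p.1.1 then 1 else 0) - if i = p.1.2 then 1 else 0) := by
  simp only [raise, Pi.add_apply, Finset.sum_apply, Pi.smul_apply, Pi.sub_apply, Pi.single_apply,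
    smul_eq_mul]

theorem raise_cons_zero {l : ℕ} (K : Pairs l → ℕ) (k : Fin l → ℕ) (m : ℤ) (alpha : Fin l → ℤ) :
    raise (exponentEquiv l (K, k)) (Fin.cons m alpha : Fin (l + 1) → ℤ) 0 = m + ∑ j, (k j : ℤ) := by
  rw [raise_apply, sum_pairs_succ]
  simp only [exponentEquiv_pairsSucc, Sum.elim_inl, Sum.elim_inr]
  simp only [pairsSucc, Sum.elim_inl, Sum.elim_inr, Fin.cons_zero,
    (Fin.succ_ne_zero _).symm, if_true, if_false, sub_zero, mul_zero, mul_one,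
    Finset.sum_const_zero, zero_add]

theorem raise_cons_succ {l : ℕ} (K : Pairs l → ℕ) (k : Fin l → ℕ) (m : ℤ) (alpha : Fin l → ℤ)
    (i : Fin l) : raise (exponentEquiv l (K, k)) (Fin.cons m alpha : Fin (l + 1) → ℤ) i.succ =
      raise K alpha i - k i := by
  rw [raise_apply, sum_pairs_succ, raise_apply]
  simp only [exponentEquiv_pairsSucc, Sum.elim_inl, Sum.elim_inr]
  simp only [pairsSucc, Sum.elim_inl, Sum.elim_inr, Fin.cons_succ,
    Fin.succ_ne_zero, if_false, Fin.succ_inj, zero_sub, mul_neg, mul_ite, mul_one, mul_zero,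
    Finset.sum_neg_distrib, Finset.sum_ite_eq, Finset.mem_univ, if_true]
  ring

/-- Nonnegativity of the later entries bounds each exponent `k i` of a pair with the first position
by the entry raised by the other pairs, which are finite in number of choices by induction. -/
theorem finite_exponents {l : ℕ} (alpha : Fin l → ℤ) :
    {K : Pairs l → ℕ | ∀ i, 0 ≤ raise K alpha i}.Finite := by
  induction l with
  | zero =>
    have : IsEmpty (Pairs 0) := ⟨fun p => p.1.1.elim0⟩
    exact Set.toFinite _
  | succ l ih =>
    obtain ⟨m, beta, rfl⟩ : ∃ (m : ℤ) (beta : Fin l → ℤ), alpha = Fin.cons m beta :=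
      ⟨alpha 0, Fin.tail alpha, (Fin.cons_self_tail alpha).symm⟩
    refine (((ih beta).biUnion fun K _ => ((Set.finite_singleton K).prod
      (Set.finite_Icc 0 fun i => (raise K beta i).toNat))).image (exponentEquiv l)).subset ?_
    intro K' hK'
    obtain ⟨⟨K, k⟩, rfl⟩ := (exponentEquiv l).surjective K'
    have h : ∀ i, (k i : ℤ) ≤ raise K beta i := fun i => by
      have := hK' i.succ
      rw [raise_cons_succ] at this
      omega
    refine ⟨(K, k), ?_, rfl⟩
    simp only [Set.mem_iUnion]
    refine ⟨K, fun i => (Int.natCast_nonneg _).trans (h i), rfl, ?_⟩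
    refine ⟨fun i => Nat.zero_le _, fun i => ?_⟩
    have := h i
    simp only
    omega

/-- `∏_{i < j} (1 - R_{ij}) / (1 - t R_{ij})` applied to `q_{α_1} ⋯ q_{α_l}`, in the ring of
symmetric functions. -/
def raisingLam {l : ℕ} (alpha : Fin l → ℤ) : Lam :=
  ∑ᶠ K : Pairs l → ℕ, (∏ p : Pairs l, raisingCoeff (K p)) • ∏ i : Fin l, hInt 1 (raise K alpha i)

theorem prod_hInt_eq_zero {l : ℕ} {beta : Fin l → ℤ} {i : Fin l} (h : beta i < 0) :
    ∏ i, hInt 1 (beta i) = 0 :=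
  Finset.prod_eq_zero (Finset.mem_univ i) (hInt_of_neg _ h)

theorem support_raising_subset {l : ℕ} (alpha : Fin l → ℤ) :
    (Function.support fun K : Pairs l → ℕ => (∏ p : Pairs l, raisingCoeff (K p)) •
      ∏ i : Fin l, hInt 1 (raise K alpha i)) ⊆ {K | ∀ i, 0 ≤ raise K alpha i} := by
  intro K hK i
  by_contra h
  exact hK (by simp only [prod_hInt_eq_zero (not_le.1 h), smul_zero])

theorem toSeries_raisingLam {l : ℕ} (alpha : Fin l → ℤ) :
    toSeries (raisingLam alpha) = raisingSum alpha := by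
  have h := AddMonoidHom.map_finsum (toSeries : Lam →+ Series)
    ((finite_exponents alpha).subset (support_raising_subset alpha))
  refine h.trans (finsum_congr fun K => ?_)
  change toSeries _ = _
  rw [map_smul, map_prod]
  simp only [toSeries_hInt]

theorem prod_monomial {ι : Type*} (s : Finset ι) (k : ι → ℕ) (c : ι → Lam) :
    ∏ i ∈ s, Polynomial.monomial (k i) (c i) =
      Polynomial.monomial (∑ i ∈ s, k i) (∏ i ∈ s, c i) := by
  classical
  induction s using Finset.induction_on with
  | empty => simp
  | insert a s ha ih =>
    rw [Finset.prod_insert ha, Finset.sum_insert ha, Finset.prod_insert ha, ih,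
      Polynomial.monomial_mul_monomial]

/-- The substitution is multiplicative and lowers each index by some `k i` with weight `raisingCoeff
(k i)`; the contraction adds the total to `m`. This is the effect of the operators `R_{1j}`. -/
theorem creation_prod_hInt {l : ℕ} (m : ℤ) (beta : Fin l → ℤ) :
    creation m (∏ i, hInt 1 (beta i)) = ∑ᶠ k : Fin l → ℕ, (∏ i, raisingCoeff (k i)) •
      (hInt 1 (m + ∑ i, (k i : ℤ)) * ∏ i, hInt 1 (beta i - k i)) := by
  obtain ⟨N, hN⟩ : ∃ N : ℕ, ∀ i, beta i < N := by
    refine ⟨∑ i, (beta i).natAbs + 1, fun i => ?_⟩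
    have := Finset.single_le_sum (f := fun i => (beta i).natAbs) (fun _ _ => Nat.zero_le _)
      (Finset.mem_univ i)
    omega
  -- If some `k i ≥ N`, then `beta i - k i` is negative and the term is zero.
  rw [finsum_eq_sum_of_support_subset (s := Fintype.piFinset fun _ => Finset.range N)]
  · rw [creation, vertexOp_apply, map_prod, Finset.prod_congr rfl fun i _ =>
      shift_hInt (c := raisingCoeff) (by simp [raisingCoeff])
        (fun i => by rw [sum_one_sub_mul_raisingCoeff]; ring) _ _ (hN i),
      Finset.prod_univ_sum, map_sum]
    refine Finset.sum_congr rfl fun k _ => ?_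
    rw [prod_monomial, contract_monomial, Finset.prod_smul, smul_mul_assoc, mul_comm, Nat.cast_sum]
  · intro k hk
    rw [Finset.mem_coe, Fintype.mem_piFinset]
    intro i
    rw [Finset.mem_range]
    by_contra h
    refine hk ?_
    have hi : beta i - k i < 0 := by have := hN i; omega
    have h0 : ∏ i, hInt 1 (beta i - k i) = 0 :=
      prod_hInt_eq_zero (beta := fun i => beta i - k i) hi
    simp only [h0, mul_zero, smul_zero]

theorem raisingLam_cons {l : ℕ} (m : ℤ) (alpha : Fin l → ℤ) :
    raisingLam (Fin.cons m alpha : Fin (l + 1) → ℤ) = creation m (raisingLam alpha) := by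
  have hfin := (finite_exponents (Fin.cons m alpha : Fin (l + 1) → ℤ)).subset
    (support_raising_subset _)
  rw [raisingLam, ← finsum_comp_equiv (exponentEquiv l), finsum_curry]
  · have h := AddMonoidHom.map_finsum (creation m : Lam →+ Lam)
      ((finite_exponents alpha).subset (support_raising_subset alpha))
    refine Eq.trans (finsum_congr fun K => ?_) h.symm
    change _ = creation m _
    rw [map_smul, creation_prod_hInt, smul_finsum]
    refine finsum_congr fun k => ?_
    rw [prod_pairs_succ, Fin.prod_univ_succ, smul_smul]
    simp only [exponentEquiv_pairsSucc, raise_cons_zero, raise_cons_succ, Sum.elim_inl,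
      Sum.elim_inr]
  · exact hfin.preimage (exponentEquiv l).injective.injOn

theorem raisingLam_get (l : List ℕ) : raisingLam (fun i : Fin l.length => (l.get i : ℤ)) = rowQ l := by
  induction l with
  | nil =>
    have : IsEmpty (Pairs ([] : List ℕ).length) := ⟨fun p => p.1.1.elim0⟩
    have : IsEmpty (Fin ([] : List ℕ).length) := ⟨fun i => i.elim0⟩
    rw [raisingLam, finsum_unique]
    simp [rowQ_nil]
  | cons m l ih =>
    rw [rowQ_cons, ← ih, ← raisingLam_cons]
    congr 1
    funext i
    induction i using Fin.cases with
    | zero => rfl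
    | succ i => rfl

theorem hallLittlewoodQ_eq {n : ℕ} (lam : n.Partition) :
    hallLittlewoodQ lam = toSeries (rowQ (rows lam)) := by
  rw [hallLittlewoodQ, ← toSeries_raisingLam, raisingLam_get]

theorem hallLittlewoodP_eq (lam : Σ n : ℕ, n.Partition) :
    hallLittlewoodP lam = toSeries ((b lam.2)⁻¹ • rowQ (rows lam.2)) := by
  rw [hallLittlewoodP, hallLittlewoodQ_eq, map_smul]

/-! ### Green polynomials as inner products -/

/-- Pull the expansion back along the injective realization and pair with `Q_λ`. Uniqueness follows,
as does the independence of `greenX` from the choice made by `Classical.epsilon`. -/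
theorem IsExpansion.apply_eq {n : ℕ} {mu : n.Partition} {c : (Σ m : ℕ, m.Partition) →₀ F}
    (hc : IsExpansion mu c) (lam : Σ m : ℕ, m.Partition) :
    c lam = pairing (pwMul mu.parts) (rowQ (rows lam.2)) := by
  have h : pwMul mu.parts =
      Finsupp.linearCombination F (fun lam => (b lam.2)⁻¹ • rowQ (rows lam.2)) c := by
    refine toSeries_injective ?_
    rw [toSeries_pwMul, hc, Finsupp.linearCombination_apply, Finsupp.linearCombination_apply,
      map_finsuppSum]
    refine Finsupp.sum_congr fun nu _ => ?_
    rw [map_smul, hallLittlewoodP_eq]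
  rw [h, Finsupp.linearCombination_apply, Finsupp.sum, map_sum, LinearMap.sum_apply,
    Finset.sum_eq_single lam]
  · rw [map_smul, map_smul, LinearMap.smul_apply, LinearMap.smul_apply, pairing_rowQ_rows,
      if_pos rfl, smul_eq_mul, smul_eq_mul, inv_mul_cancel₀ (b_ne_zero lam.2), mul_one]
  · intro nu _ hne
    rw [map_smul, map_smul, LinearMap.smul_apply, LinearMap.smul_apply, pairing_rowQ_rows,
      if_neg hne, smul_zero, smul_zero]
  · intro hl
    rw [Finsupp.notMem_support_iff.1 hl]
    simp

theorem powerSumPart_eq_sum {n : ℕ} (mu : n.Partition) : powerSumPart mu =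
    ∑ nu : n.Partition, pairing (pwMul mu.parts) (rowQ (rows nu)) • hallLittlewoodP ⟨n, nu⟩ := by
  rw [← toSeries_pwMul, pwMul_eq_sum mu, map_sum]
  refine Finset.sum_congr rfl fun nu _ => ?_
  rw [← pwMul_eq_sum mu, map_smul, hallLittlewoodP_eq]

theorem exists_isExpansion {n : ℕ} (mu : n.Partition) :
    ∃ c : (Σ m : ℕ, m.Partition) →₀ F, IsExpansion mu c := by
  refine ⟨∑ nu : n.Partition,
    Finsupp.single ⟨n, nu⟩ (pairing (pwMul mu.parts) (rowQ (rows nu))), ?_⟩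
  rw [IsExpansion, map_sum, powerSumPart_eq_sum]
  refine Finset.sum_congr rfl fun nu _ => ?_
  rw [Finsupp.linearCombination_single]

theorem existsUnique_isExpansion {n : ℕ} (mu : n.Partition) :
    ∃! c : (Σ m : ℕ, m.Partition) →₀ F, IsExpansion mu c := by
  obtain ⟨c, hc⟩ := exists_isExpansion mu
  refine ⟨c, hc, fun c' hc' => ?_⟩
  ext lam
  rw [hc.apply_eq, hc'.apply_eq]

theorem greenX_eq_pairing {m n : ℕ} (lam : m.Partition) (mu : n.Partition) :
    greenX lam mu = pairing (pwMul mu.parts) (rowQ (rows lam)) :=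
  (Classical.epsilon_spec (exists_isExpansion mu)).apply_eq ⟨m, lam⟩

/-- The empty partition also fits, because `creation 0` fixes `1`. -/
theorem rowQ_rows {n : ℕ} (lam : n.Partition) :
    rowQ (rows lam) = creation (firstPart lam) (rowQ (rows (removeFirst lam))) := by
  by_cases h : lam.parts = 0
  · have h1 : firstPart lam = 0 := by rw [firstPart, h]; rfl
    have h2 : rows lam = [] := by rw [rows, h, Multiset.sort_zero]
    have h3 : rows (removeFirst lam) = [] := by
      change (lam.parts.erase (firstPart lam)).sort (· ≥ ·) = []
      rw [h, Multiset.erase_zero, Multiset.sort_zero]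
    rw [h2, h3, h1, rowQ_nil, Nat.cast_zero, creation_zero_one]
  · have h1 : rows lam = firstPart lam :: rows (removeFirst lam) := by
      have h2 : lam.parts = firstPart lam ::ₘ (removeFirst lam).parts :=
        (Multiset.cons_erase (sup_mem h)).symm
      rw [rows, rows, h2, Multiset.sort_cons]
      intro x hx
      exact Multiset.le_sup (Multiset.mem_of_mem_erase hx)
    rw [h1, rowQ_cons]

theorem firstPart_le {n : ℕ} (lam : n.Partition) : firstPart lam ≤ n := by
  by_cases h : lam.parts = 0
  · rw [firstPart, h]; exact Nat.zero_le n
  · have := Multiset.le_sum_of_mem (sup_mem h)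
    rwa [lam.parts_sum] at this

/-! ### The recurrence -/

theorem shift_pwMul {s : Multiset ℕ} (hs : ∀ i ∈ s, 0 < i) (ε : F) : shift ε (pwMul s) =
    (s.antidiagonal.map fun p => Polynomial.monomial p.2.sum
      (algebraMap F Lam (ε ^ p.2.card) * pwMul p.1)).sum := by
  have h : shift ε (pwMul s) = (s.map fun i =>
      Polynomial.C (pw i) + Polynomial.monomial i (algebraMap F Lam ε)).prod := by
    rw [pwMul, map_multiset_prod, Multiset.map_map]
    congr 1
    refine Multiset.map_congr rfl fun i hi => ?_
    rw [Function.comp_apply, pw, shift_X, Nat.sub_add_cancel (hs i hi)]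
  have h2 : ∀ s' : Multiset ℕ, (s'.map fun i => Polynomial.monomial i (algebraMap F Lam ε)).prod =
      Polynomial.monomial s'.sum (algebraMap F Lam (ε ^ s'.card)) := by
    intro s'
    induction s' using Multiset.induction with
    | empty => simp
    | cons i s' ih =>
      rw [Multiset.map_cons, Multiset.prod_cons, ih, Polynomial.monomial_mul_monomial,
        Multiset.sum_cons, Multiset.card_cons, pow_succ', map_mul (algebraMap F Lam)]
  rw [h, Multiset.prod_map_add]
  congr 1
  refine Multiset.map_congr rfl fun p _ => ?_
  have h3 : (p.1.map fun i => Polynomial.C (pw i)).prod = Polynomial.C (pwMul p.1) := by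
    rw [pwMul, map_multiset_prod, Multiset.map_map]
    rfl
  rw [h2, h3, Polynomial.C_mul_monomial, mul_comm]

/-- Expanding the product of the `p_i + z^i` keeps a subpartition `tau` and turns the other parts
into a power of `z`, whose exponent shifts the index of the row. `Multiset.powerset` counts the
choices of positions. -/
theorem annihilation_pwMul {s : Multiset ℕ} (hs : ∀ i ∈ s, 0 < i) (m : ℤ) :
    annihilation m (pwMul s) =
      (s.powerset.map fun tau => pwMul tau * hInt (-1) (s.sum - m - tau.sum)).sum := by
  rw [annihilation, vertexOp_apply, neg_neg, shift_pwMul hs, map_multiset_sum, Multiset.map_map,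
    ← Multiset.antidiagonal_map_fst, Multiset.map_map]
  congr 1
  refine Multiset.map_congr rfl fun p hp => ?_
  rw [Multiset.mem_antidiagonal] at hp
  rw [Function.comp_apply, Function.comp_apply, contract_monomial, one_pow, map_one, one_mul, ← hp,
    Multiset.sum_add]
  congr 2
  push_cast
  ring

theorem sum_map_filter {α M : Type*} [AddCommMonoid M] (s : Multiset α) (p : α → Prop)
    [DecidablePred p] (f g : α → M) (hp : ∀ a ∈ s, p a → f a = g a) (hn : ∀ a ∈ s, ¬p a → f a = 0) :
    (s.map f).sum = ((s.filter p).map g).sum := by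
  induction s using Multiset.induction with
  | empty => simp
  | cons a s ih =>
    have h := ih (fun x hx => hp x (Multiset.mem_cons_of_mem hx))
      fun x hx => hn x (Multiset.mem_cons_of_mem hx)
    rw [Multiset.map_cons, Multiset.sum_cons, h]
    by_cases ha : p a
    · rw [Multiset.filter_cons_of_pos _ ha, Multiset.map_cons, Multiset.sum_cons,
        hp a (Multiset.mem_cons_self a s) ha]
    · rw [Multiset.filter_cons_of_neg _ ha, hn a (Multiset.mem_cons_self a s) ha, zero_add]

theorem sum_filter_le_eq {α M : Type*} [AddCommMonoid M] (s : Multiset α) (w : α → ℕ) (N : ℕ)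
    (f : α → M) : ((s.filter fun a => w a ≤ N).map f).sum =
      ∑ i ∈ Finset.range (N + 1), ((s.filter fun a => w a = i).map f).sum := by
  induction s using Multiset.induction with
  | empty => simp
  | cons a s ih =>
    have h : ∀ i, (((a ::ₘ s).filter fun a => w a = i).map f).sum =
        (if w a = i then f a else 0) + ((s.filter fun a => w a = i).map f).sum := by
      intro i
      by_cases ha : w a = i
      · rw [Multiset.filter_cons_of_pos (p := fun a => w a = i) _ ha, Multiset.map_cons, Multiset.sum_cons, if_pos ha]
      · rw [Multiset.filter_cons_of_neg (p := fun a => w a = i) _ ha, if_neg ha, zero_add]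
    rw [Finset.sum_congr rfl fun i _ => h i, Finset.sum_add_distrib, ← ih, Finset.sum_ite_eq]
    by_cases ha : w a ≤ N
    · rw [Multiset.filter_cons_of_pos (p := fun a => w a ≤ N) _ ha, Multiset.map_cons, Multiset.sum_cons,
        if_pos (Finset.mem_range.2 (by omega))]
    · rw [Multiset.filter_cons_of_neg (p := fun a => w a ≤ N) _ ha, if_neg (by rw [Finset.mem_range]; omega), zero_add]

theorem pwMul_add (s s' : Multiset ℕ) : pwMul (s + s') = pwMul s * pwMul s' := by
  rw [pwMul, Multiset.map_add, Multiset.prod_add]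
  rfl

theorem greenX_recurrence {n : ℕ} (lam mu : n.Partition) : greenX lam mu =
    (((subpartitions mu).filter fun tau => tau.sum ≤ n - firstPart lam).map
      fun tau => ∑ rho : (n - firstPart lam - tau.sum).Partition,
        (-1) ^ rho.parts.card / z rho *
          greenX (removeFirst lam) (Nat.Partition.ofMultiset (tau + rho.parts))).sum := by
  have hle := firstPart_le lam
  rw [greenX_eq_pairing, rowQ_rows, pairing_comm, pairing_creation,
    annihilation_pwMul fun i hi => mu.parts_pos hi, map_multiset_sum, Multiset.map_map, mu.parts_sum]
  refine sum_map_filter _ _ _ _ ?_ ?_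
  · intro tau htau hsum
    have hpos : ∀ i ∈ tau, 0 < i := fun i hi =>
      mu.parts_pos (Multiset.mem_of_le (Multiset.mem_powerset.1 htau) hi)
    have hidx : (n : ℤ) - firstPart lam - tau.sum = (n - firstPart lam - tau.sum : ℕ) := by omega
    rw [Function.comp_apply, hidx, hInt_natCast, hRow_eq_sum, Finset.mul_sum, map_sum]
    refine Finset.sum_congr rfl fun rho _ => ?_
    -- `Nat.Partition.ofMultiset` discards zeros; here there are none.
    have hparts : (Nat.Partition.ofMultiset (tau + rho.parts)).parts = tau + rho.parts := by
      refine Multiset.filter_eq_self.2 fun i hi => ?_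
      rcases Multiset.mem_add.1 hi with h | h
      · exact (hpos i h).ne'
      · exact (rho.parts_pos h).ne'
    rw [greenX_eq_pairing, hparts, pwMul_add, mul_smul_comm, map_smul, smul_eq_mul, pairing_comm]
  -- A subpartition that is too large gives a row of negative index, which is zero.
  · intro tau _ hsum
    rw [Function.comp_apply, hInt_of_neg _ (by omega), mul_zero, map_zero]

theorem greenX_recurrence_by_size {n : ℕ} (lam mu : n.Partition) : greenX lam mu =
    ∑ i ∈ Finset.range (n - firstPart lam + 1),
      (((subpartitions mu).filter fun tau => tau.sum = i).map
        fun tau => ∑ rho : (n - firstPart lam - i).Partition,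
          (-1) ^ rho.parts.card / z rho *
            greenX (removeFirst lam) (Nat.Partition.ofMultiset (tau + rho.parts))).sum := by
  rw [greenX_recurrence, sum_filter_le_eq]
  refine Finset.sum_congr rfl fun i _ => ?_
  congr 1
  refine Multiset.map_congr rfl fun tau htau => ?_
  obtain rfl := (Multiset.mem_filter.1 htau).2
  rfl

end Green

end

theorem mainTheorem2 {n : ℕ} (lam mu : n.Partition) :
    (∃! c : (Σ m : ℕ, m.Partition) →₀ Green.F, Green.IsExpansion mu c) ∧
    Green.powerSumPart mu =
      ∑ nu : n.Partition, Green.greenX nu mu • Green.hallLittlewoodP ⟨n, nu⟩ ∧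
    Green.greenX lam mu =
      (((Green.subpartitions mu).filter fun tau => tau.sum ≤ n - Green.firstPart lam).map
        fun tau => ∑ rho : (n - Green.firstPart lam - tau.sum).Partition,
          (-1) ^ rho.parts.card / Green.z rho *
            Green.greenX (Green.removeFirst lam)
              (Nat.Partition.ofMultiset (tau + rho.parts))).sum ∧
    Green.greenX lam mu =
      ∑ i ∈ Finset.range (n - Green.firstPart lam + 1),
        (((Green.subpartitions mu).filter fun tau => tau.sum = i).map
          fun tau => ∑ rho : (n - Green.firstPart lam - i).Partition,
            (-1) ^ rho.parts.card / Green.z rho *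
              Green.greenX (Green.removeFirst lam)
                (Nat.Partition.ofMultiset (tau + rho.parts))).sum := by
  refine ⟨Green.existsUnique_isExpansion mu, ?_, Green.greenX_recurrence lam mu,
    Green.greenX_recurrence_by_size lam mu⟩
  simp only [Green.greenX_eq_pairing]
  exact Green.powerSumPart_eq_sum mu
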